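/- Let $s\in(0,1)$, let $N\ge 1$ be an integer with $N>2s$, let $m>0$, and put $2^*_s:=\frac{2N}{N-2s}$. Let $g\colon\mathbb R\to\mathbb R$ satisfy (g0) $g$ is continuous and $g(0)=0$; (g1) $\limsup_{t\to0}\frac{g(t)}{t}\le 0$; (g2) $\limsup_{|t|\to+\infty}\frac{|g(t)|}{|t|^{2^*_s-1}}<\infty$, and let $G(t):=\int_0^t g(\tau)\,d\tau$. Let $H^s(\mathbb R^N)$ be the fractional Sobolev space of real-valued functions $u\in L^2(\mathbb R^N)$ with $|\xi|^s\mathcal F(u)\in L^2(\mathbb R^N)$. For $\mu\in\mathbb R$ and $u\in H^s(\mathbb R^N)$ define, with values in $\mathbb R\cup\{+\infty\}$, $$K(u):=\frac12\int_{\mathbb R^N}|(-\Delta)^{s/2}u|^2\,dx-\int_{\mathbb R^N}G(u)\,dx,$$ $$I^m(\mu,u):=\frac12\int_{\mathbb R^N}|(-\Delta)^{s/2}u|^2\,dx+\frac\mu2\Big(\int_{\mathbb R^N}u^2\,dx-m\Big)-\int_{\mathbb R^N}G(u)\,dx,$$ $$P(\mu,u):=\int_{\mathbb R^N}|(-\Delta)^{s/2}u|^2\,dx+2^*_s\int_{\mathbb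 R^N}\Big(\frac\mu2u^2-G(u)\Big)\,dx,$$ and let $$\mathcal S_m:=\Big\{u\in H^s(\mathbb R^N):\int_{\mathbb R^N}u^2\,dx=m\Big\},\qquad \mathcal P:=\{(\mu,u)\in\mathbb R\times H^s(\mathbb R^N):u\ne0,\ P(\mu,u)=0\}.$$ Then for every $\mu\in\mathbb R$ and every $u\in H^s(\mathbb R^N)$ the following are equivalent: (a) $u$ is an $L^2$-minimum with Lagrange multiplier $\mu$, that is, $u\in\mathcal S_m$, $K(u)=\min_{\mathcal S_m}K$, and $u$ is a weak solution of $(-\Delta)^su+\mu u=g(u)$ in $\mathbb R^N$, meaning $$\int_{\mathbb R^N}(-\Delta)^{s/2}u\,(-\Delta)^{s/2}\varphi\,dx+\mu\int_{\mathbb R^N}u\varphi\,dx=\int_{\mathbb R^N}g(u)\varphi\,dx\qquad\text{for all }\varphi\in H^s(\mathbb R^N)\cap L^1(\mathbb R^N);$$ (b) $(\mu,u)$ is a Pohožaev minimum over $\mathcal P$, that is, $(\mu,u)\in\mathcal P$ and $I^m(\mu,u)=\min_{\mathcal P}I^m$. -/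

import Mathlib

open MeasureTheory Filter Topology
open scoped FourierTransform ENNReal

noncomputable section

namespace FracNLS

/-- The Euclidean space `ℝ^N`. -/
abbrev RN (N : ℕ) : Type := EuclideanSpace ℝ (Fin N)

/-- The Fourier transform (Plancherel extension) of a real-valued `u ∈ L²(ℝ^N)`. -/
def fourierL2 {N : ℕ} (u : Lp ℝ 2 (volume : Measure (RN N))) :
    Lp ℂ 2 (volume : Measure (RN N)) :=
  𝓕 (Complex.ofRealCLM.compLp u)

/-- The function `|2πξ|^s 𝓕u(ξ)`. Mathlib's Fourier transform is normalised as
`𝓕u(ξ) = ∫ exp(-2πi x·ξ) u(x) dx`, for which the symbol of `-Δ` is `|2πξ|²`. -/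
def symbolMul {N : ℕ} (s : ℝ) (u : Lp ℝ 2 (volume : Measure (RN N))) : RN N → ℂ :=
  fun ξ => (((2 * Real.pi * ‖ξ‖) ^ s : ℝ) : ℂ) * fourierL2 u ξ

theorem fourierL2_zero {N : ℕ} : fourierL2 (0 : Lp ℝ 2 (volume : Measure (RN N))) = 0 := by
  have h : Complex.ofRealCLM.compLp (0 : Lp ℝ 2 (volume : Measure (RN N))) = 0 :=
    map_zero (Complex.ofRealCLM.compLpL 2 (volume : Measure (RN N)))
  have h' : (𝓕 (0 : Lp ℂ 2 (volume : Measure (RN N)))) = 0 :=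
    map_zero (Lp.fourierTransformₗᵢ (RN N) ℂ)
  rw [fourierL2, h, h']

theorem fourierL2_add {N : ℕ} (u v : Lp ℝ 2 (volume : Measure (RN N))) :
    fourierL2 (u + v) = fourierL2 u + fourierL2 v := by
  have h : Complex.ofRealCLM.compLp (u + v)
      = Complex.ofRealCLM.compLp u + Complex.ofRealCLM.compLp v :=
    map_add (Complex.ofRealCLM.compLpL 2 (volume : Measure (RN N))) u v
  rw [fourierL2, h]
  exact map_add (Lp.fourierTransformₗᵢ (RN N) ℂ) _ _

theorem fourierL2_smul {N : ℕ} (c : ℝ) (u : Lp ℝ 2 (volume : Measure (RN N))) :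
    fourierL2 (c • u) = (c : ℂ) • fourierL2 u := by
  have h : Complex.ofRealCLM.compLp (c • u) = (c : ℂ) • Complex.ofRealCLM.compLp u := by
    have h1 : Complex.ofRealCLM.compLp (c • u) = c • Complex.ofRealCLM.compLp u :=
      map_smul (Complex.ofRealCLM.compLpL 2 (volume : Measure (RN N))) c u
    rw [h1]
    ext1
    filter_upwards [Lp.coeFn_smul c (Complex.ofRealCLM.compLp u),
      Lp.coeFn_smul (c : ℂ) (Complex.ofRealCLM.compLp u)] with x h2 h3
    rw [h2, h3]
    simp
  rw [fourierL2, h]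
  exact map_smul (Lp.fourierTransformₗᵢ (RN N) ℂ) _ _

/-- The fractional Sobolev space `H^s(ℝ^N)` of real-valued functions: all `u ∈ L²(ℝ^N)` such that
`|ξ|^s 𝓕u ∈ L²(ℝ^N)`. Its elements are classes of functions modulo a.e. equality. -/
def Hs (N : ℕ) (s : ℝ) : Submodule ℝ (Lp ℝ 2 (volume : Measure (RN N))) where
  carrier := {u | MemLp (symbolMul s u) 2 volume}
  zero_mem' := by
    refine (MemLp.zero (p := 2) (μ := (volume : Measure (RN N))) (ε := ℂ)).ae_eq ?_
    filter_upwards [Lp.coeFn_zero ℂ 2 (volume : Measure (RN N))] with ξ h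
    simp only [symbolMul, fourierL2_zero, h, Pi.zero_apply, mul_zero]
  add_mem' := by
    intro u v hu hv
    refine (MemLp.add hu hv).ae_eq ?_
    filter_upwards [Lp.coeFn_add (fourierL2 u) (fourierL2 v)] with ξ h
    rw [Pi.add_apply] at h
    simp only [symbolMul, Pi.add_apply, fourierL2_add, h, mul_add]
  smul_mem' := by
    intro c u hu
    refine (MemLp.const_smul hu (c : ℂ)).ae_eq ?_
    filter_upwards [Lp.coeFn_smul (c : ℂ) (fourierL2 u)] with ξ h
    rw [Pi.smul_apply, smul_eq_mul] at h
    simp only [symbolMul, Pi.smul_apply, smul_eq_mul, fourierL2_smul, h, mul_left_comm]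

/-- `(-Δ)^{s/2} u = 𝓕⁻¹(|2πξ|^s 𝓕u) ∈ L²(ℝ^N)` for `u ∈ H^s(ℝ^N)`. As `u` is real-valued and the
symbol is even, this function is real-valued, but it is recorded as an element of the complex
`L²` space. -/
def halfLap {N : ℕ} {s : ℝ} (u : Hs N s) : Lp ℂ 2 (volume : Measure (RN N)) :=
  𝓕⁻ (MemLp.toLp (symbolMul s (u : Lp ℝ 2 (volume : Measure (RN N)))) u.2)

/-- `∫ |(-Δ)^{s/2} u|² dx`. -/
def kinetic {N : ℕ} {s : ℝ} (u : Hs N s) : ℝ :=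
  ∫ x, ‖halfLap u x‖ ^ 2

/-- `∫ (-Δ)^{s/2} u (-Δ)^{s/2} φ dx`. Both functions take real values, and for such values
the real inner product of `ℂ` is the ordinary product. -/
def kineticForm {N : ℕ} {s : ℝ} (u φ : Hs N s) : ℝ :=
  ∫ x, inner ℝ (halfLap u x) (halfLap φ x)

/-- The mass `∫ u² dx`. -/
def mass {N : ℕ} {s : ℝ} (u : Hs N s) : ℝ :=
  ∫ x, ((u : Lp ℝ 2 (volume : Measure (RN N))) x) ^ 2

/-- The critical Sobolev exponent `2^*_s = 2N / (N - 2s)`. -/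
def critExp (N : ℕ) (s : ℝ) : ℝ := 2 * N / (N - 2 * s)

/-- The primitive `G(t) = ∫_0^t g(τ) dτ`. -/
def primitive (g : ℝ → ℝ) (t : ℝ) : ℝ := ∫ τ in (0 : ℝ)..t, g τ

/-- (g0): `g` is continuous and `g 0 = 0`. -/
def CondG0 (g : ℝ → ℝ) : Prop := Continuous g ∧ g 0 = 0

/-- (g1): `limsup_{t → 0} g(t)/t ≤ 0`, the upper limit being taken in `[-∞, +∞]`. -/
def CondG1 (g : ℝ → ℝ) : Prop :=
  limsup (fun t : ℝ => ((g t / t : ℝ) : EReal)) (𝓝[≠] 0) ≤ 0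

/-- (g2): `limsup_{|t| → +∞} |g(t)| / |t|^{2^*_s - 1} < ∞`, the upper limit being taken in
`[-∞, +∞]`. -/
def CondG2 (N : ℕ) (s : ℝ) (g : ℝ → ℝ) : Prop :=
  limsup (fun t : ℝ => ((|g t| / |t| ^ (critExp N s - 1) : ℝ) : EReal))
    (comap (fun t : ℝ => |t|) atTop) < ⊤

/-- The integral `∫ f = ∫ f⁺ - ∫ f⁻` with values in `[-∞, +∞]`, meaningful as soon as at least one
of the two terms is finite. -/
def extIntegral {N : ℕ} (f : RN N → ℝ) : EReal :=
  ((∫⁻ x, ENNReal.ofReal (f x) : ℝ≥0∞) : EReal) - ((∫⁻ x, ENNReal.ofReal (-f x) : ℝ≥0∞) : EReal)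

/-- `∫ G(u) dx`. Under (g0)-(g2) the positive part of `G(u)` is integrable for every
`u ∈ H^s(ℝ^N)`, so that the value lies in `[-∞, +∞)`. -/
def potential {N : ℕ} {s : ℝ} (g : ℝ → ℝ) (u : Hs N s) : EReal :=
  extIntegral fun x => primitive g ((u : Lp ℝ 2 (volume : Measure (RN N))) x)

/-- The energy `K(u) = 1/2 ∫ |(-Δ)^{s/2} u|² - ∫ G(u)`, with values in `ℝ ∪ {+∞}`
under (g0)-(g2). -/
def energy {N : ℕ} {s : ℝ} (g : ℝ → ℝ) (u : Hs N s) : EReal :=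
  ((kinetic u / 2 : ℝ) : EReal) - potential g u

/-- The Lagrangian
`I^m(μ,u) = 1/2 ∫ |(-Δ)^{s/2} u|² + μ/2 (∫ u² - m) - ∫ G(u)`. -/
def lagrangian {N : ℕ} {s : ℝ} (g : ℝ → ℝ) (m : ℝ) (p : ℝ × Hs N s) : EReal :=
  ((kinetic p.2 / 2 + p.1 / 2 * (mass p.2 - m) : ℝ) : EReal) - potential g p.2

/-- The Pohozaev functional
`P(μ,u) = ∫ |(-Δ)^{s/2} u|² + 2^*_s ∫ (μ/2 u² - G(u))`. -/
def pohozaev {N : ℕ} {s : ℝ} (g : ℝ → ℝ) (p : ℝ × Hs N s) : EReal :=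
  ((kinetic p.2 : ℝ) : EReal) +
    ((critExp N s : ℝ) : EReal) * (((p.1 / 2 * mass p.2 : ℝ) : EReal) - potential g p.2)

/-- The `L²`-sphere `S_m = {u ∈ H^s(ℝ^N) | ∫ u² = m}`. -/
def sphere (N : ℕ) (s m : ℝ) : Set (Hs N s) := {u | mass u = m}

/-- The Pohozaev set `{(μ,u) ∈ ℝ × H^s(ℝ^N) | u ≠ 0, P(μ,u) = 0}`. -/
def pohozaevSet (N : ℕ) (s : ℝ) (g : ℝ → ℝ) : Set (ℝ × Hs N s) :=
  {p | p.2 ≠ 0 ∧ pohozaev g p = 0}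

/-- `u` is a weak solution of `(-Δ)^s u + μ u = g(u)` in `ℝ^N`: the equation holds against every
test function `φ ∈ H^s(ℝ^N) ∩ L¹(ℝ^N)`. Under (g0)-(g2) all the integrands are integrable. -/
def IsWeakSolution {N : ℕ} {s : ℝ} (g : ℝ → ℝ) (μ : ℝ) (u : Hs N s) : Prop :=
  ∀ φ : Hs N s, Integrable (φ : Lp ℝ 2 (volume : Measure (RN N))) volume →
    kineticForm u φ
      + μ * ∫ x, (u : Lp ℝ 2 (volume : Measure (RN N))) x
          * (φ : Lp ℝ 2 (volume : Measure (RN N))) x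
      = ∫ x, g ((u : Lp ℝ 2 (volume : Measure (RN N))) x)
          * (φ : Lp ℝ 2 (volume : Measure (RN N))) x

/-- `u` is an `L²`-minimum with Lagrange multiplier `μ`: it lies on the sphere `S_m`, minimises
the energy there, and solves `(-Δ)^s u + μ u = g(u)`. -/
def IsL2Minimum {N : ℕ} {s : ℝ} (g : ℝ → ℝ) (m μ : ℝ) (u : Hs N s) : Prop :=
  u ∈ sphere N s m ∧ IsMinOn (energy g) (sphere N s m) u ∧ IsWeakSolution g μ u

/-- `(μ,u)` is a Pohozaev minimum: it lies in the Pohozaev set and minimises `I^m` there. -/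
def IsPohozaevMinimum {N : ℕ} {s : ℝ} (g : ℝ → ℝ) (m μ : ℝ) (u : Hs N s) : Prop :=
  (μ, u) ∈ pohozaevSet N s g ∧ IsMinOn (lagrangian g m) (pohozaevSet N s g) (μ, u)

end FracNLS

end

/-!
For `u ≠ 0` with `∫ G(u)` finite, the identity `P(μ,u) = 0` determines `μ`, and inserting this
multiplier into `I^m` leaves a functional `J(u)` of `u` alone, which on the sphere `S_m` is the
energy `K`. With `x = m / ∫ v²`, rescaling `v` in space to mass `m` multiplies the kinetic energy by
`x^a`, where `a = (N - 2s) / N`, and `∫ G(v)` by `x`, while `J(v)` carries the tangent line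
`1 + a (x - 1)` in place of `x^a`. By Bernoulli's inequality, rescaling to `S_m` therefore lowers
`J`, strictly if `v ∉ S_m`. Hence minimising `K` on `S_m`, minimising `J`, and minimising `I^m` on
the Pohozaev set are the same problem. The Euler-Lagrange equation of `J` at a point of `S_m` is the
weak equation with the Pohozaev multiplier, and a nonzero `u` solves the weak equation for at most
one multiplier.

The test functions have to be integrable because `∫ |g(u) φ|` is controlled by
`∫ (1 + |u|^{2^*_s - 1}) |φ|`. Since the positive part of `G(u)` is at most of order
`u² + |u|^{2^*_s}`, its integrability is the critical Sobolev embedding. This is proved by splitting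
`f = 𝓕 u` at the frequency `A = A(t)`: by Cauchy-Schwarz the low frequencies contribute at most
`t / 2` pointwise, by Plancherel the high ones control the measure of `{t < |u|}`, and integrating
`t^{p-1}` against this bound gives the `L^p` norm for `p = 2^*_s`.
-/

noncomputable section

namespace FracNLS

section WeakTypeInterpolation

theorem lintegral_Ioc_rpow {q R : ℝ} (hq : -1 < q) (hR : 0 ≤ R) :
    ∫⁻ t in Set.Ioc 0 R, ENNReal.ofReal (t ^ q) = ENNReal.ofReal (R ^ (q + 1) / (q + 1)) := by
  have hint : IntervalIntegrable (fun t : ℝ => t ^ q) volume 0 R :=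
    intervalIntegral.intervalIntegrable_rpow' hq
  rw [← ofReal_integral_eq_lintegral_ofReal
      ((intervalIntegrable_iff_integrableOn_Ioc_of_le hR).1 hint)
      (ae_restrict_of_forall_mem measurableSet_Ioc fun t ht => Real.rpow_nonneg ht.1.le _),
    ← intervalIntegral.integral_of_le hR, integral_rpow (Or.inl hq),
    Real.zero_rpow (by linarith), sub_zero]

theorem setLIntegral_Ioi_setLIntegral_eq {β : Type*} [MeasurableSpace β] {ν : Measure β}
    [SFinite ν] {w : β → ℝ≥0∞} {ρ : β → ℝ} {q : ℝ} (hq : -1 < q) (hw : AEMeasurable w ν)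
    (hρ : Measurable ρ) (hρ0 : ∀ ξ, 0 ≤ ρ ξ) :
    ∫⁻ t in Set.Ioi (0 : ℝ), ENNReal.ofReal (t ^ q) * ∫⁻ ξ in {ξ | t ≤ ρ ξ}, w ξ ∂ν
      = ENNReal.ofReal (1 / (q + 1)) * ∫⁻ ξ, ENNReal.ofReal (ρ ξ ^ (q + 1)) * w ξ ∂ν := by
  let S : Set (ℝ × β) := {z | z.1 ≤ ρ z.2}
  let h : ℝ × β → ℝ≥0∞ := S.indicator fun z => ENNReal.ofReal (z.1 ^ q) * w z.2
  have hq_inv : 0 ≤ 1 / (q + 1) := one_div_nonneg.2 (by linarith)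
  have hS : MeasurableSet S := measurableSet_le measurable_fst (hρ.comp measurable_snd)
  have hh : AEMeasurable h ((volume.restrict (Set.Ioi 0)).prod ν) :=
    (AEMeasurable.mul (by fun_prop) hw.comp_snd).indicator hS
  calc
    _ = ∫⁻ t in Set.Ioi (0 : ℝ), ∫⁻ ξ, h (t, ξ) ∂ν := by
      refine lintegral_congr fun t => ?_
      rw [← lintegral_const_mul' _ _ ENNReal.ofReal_ne_top,
        ← lintegral_indicator (measurableSet_le measurable_const hρ)]
      rfl
    _ = ∫⁻ ξ, (∫⁻ t in Set.Ioi (0 : ℝ), h (t, ξ)) ∂ν := lintegral_lintegral_swap hh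
    _ = ∫⁻ ξ, ENNReal.ofReal (1 / (q + 1)) * (ENNReal.ofReal (ρ ξ ^ (q + 1)) * w ξ) ∂ν := by
      refine lintegral_congr fun ξ => ?_
      have hslice : (fun t => h (t, ξ))
          = (Set.Iic (ρ ξ)).indicator fun t => ENNReal.ofReal (t ^ q) * w ξ := rfl
      rw [hslice, setLIntegral_indicator measurableSet_Iic, Set.inter_comm, Set.Ioi_inter_Iic,
        lintegral_mul_const _ (by fun_prop), lintegral_Ioc_rpow hq (hρ0 ξ), ← mul_assoc,
        ← ENNReal.ofReal_mul hq_inv, one_div_mul_eq_div]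
    _ = _ := lintegral_const_mul' _ _ ENNReal.ofReal_ne_top

theorem lintegral_rpow_le_of_measure_lt_le {α β : Type*} [MeasurableSpace α] [MeasurableSpace β]
    {μ : Measure α} {ν : Measure β} [SFinite ν] {f : α → ℝ} {w : β → ℝ≥0∞} {ρ : β → ℝ} {p q : ℝ}
    (hp : 0 < p) (hqp : q < p) (hf0 : 0 ≤ᵐ[μ] f) (hf : AEMeasurable f μ) (hw : AEMeasurable w ν)
    (hρ : Measurable ρ) (hρ0 : ∀ ξ, 0 ≤ ρ ξ)
    (hle : ∀ t > 0, μ {x | t < f x} ≤ ENNReal.ofReal (t ^ (-q)) * ∫⁻ ξ in {ξ | t ≤ ρ ξ}, w ξ ∂ν) :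
    ∫⁻ x, ENNReal.ofReal (f x ^ p) ∂μ
      ≤ ENNReal.ofReal (p / (p - q)) * ∫⁻ ξ, ENNReal.ofReal (ρ ξ ^ (p - q)) * w ξ ∂ν := by
  calc
    _ = ENNReal.ofReal p
          * ∫⁻ t in Set.Ioi 0, μ {x | t < f x} * ENNReal.ofReal (t ^ (p - 1)) :=
      lintegral_rpow_eq_lintegral_meas_lt_mul μ hf0 hf hp
    _ ≤ ENNReal.ofReal p * ∫⁻ t in Set.Ioi 0,
          ENNReal.ofReal (t ^ (p - q - 1)) * ∫⁻ ξ in {ξ | t ≤ ρ ξ}, w ξ ∂ν := by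
      gcongr ENNReal.ofReal p * ?_
      refine setLIntegral_mono' measurableSet_Ioi fun t ht => ?_
      have hpow : t ^ (p - q - 1) = t ^ (p - 1) * t ^ (-q) := by
        rw [← Real.rpow_add ht]; ring_nf
      rw [mul_comm, hpow, ENNReal.ofReal_mul (Real.rpow_nonneg (le_of_lt ht) _), mul_assoc]
      gcongr
      exact hle t ht
    _ = _ := by
      rw [setLIntegral_Ioi_setLIntegral_eq (by linarith) hw hρ hρ0, sub_add_cancel, ← mul_assoc,
        ← ENNReal.ofReal_mul hp.le, mul_one_div]

end WeakTypeInterpolation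

section FourierLp

variable {E F : Type*} [NormedAddCommGroup E] [InnerProductSpace ℝ E] [FiniteDimensional ℝ E]
  [MeasurableSpace E] [BorelSpace E] [NormedAddCommGroup F] [InnerProductSpace ℂ F]
  [CompleteSpace F]

theorem fourierInv_Lp_ae_eq {f : Lp F 2 (volume : Measure E)} (hf : Integrable f) :
    (𝓕⁻ f : Lp F 2 (volume : Measure E)) =ᵐ[volume] 𝓕⁻ (f : E → F) := by
  have hcont : Continuous (𝓕⁻ (f : E → F)) := by
    rw [← Real.Lp.fourierTransformInv_toLp (memLp_one_iff_integrable.2 hf)]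
    exact BoundedContinuousFunction.continuous _
  refine ae_eq_of_integral_contDiff_smul_eq
    ((Lp.memLp (𝓕⁻ f : Lp F 2 (volume : Measure E))).locallyIntegrable (by norm_num))
    hcont.locallyIntegrable fun g g_smooth g_cpt => ?_
  have hg_cpt : HasCompactSupport (Complex.ofRealCLM ∘ g) := g_cpt.comp_left rfl
  have hg_smooth : ContDiff ℝ (⊤ : ℕ∞) (Complex.ofRealCLM ∘ g) := by fun_prop
  let G := hg_cpt.toSchwartzMap hg_smooth
  have hLp : ∫ x, (𝓕⁻ G) x • f x
      = ∫ x, G x • (𝓕⁻ f : Lp F 2 (volume : Measure E)) x := by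
    have h : (𝓕⁻ (f : TemperedDistribution E F)) G
        = ((𝓕⁻ f : Lp F 2 (volume : Measure E)) : TemperedDistribution E F) G := by
      rw [Lp.fourierInv_toTemperedDistribution_eq]
    rwa [TemperedDistribution.fourierInv_apply, Lp.toTemperedDistribution_apply,
      Lp.toTemperedDistribution_apply] at h
  have hL1 : ∫ x, (𝓕⁻ G) x • f x = ∫ x, G x • 𝓕⁻ (f : E → F) x := by
    have h := VectorFourier.integral_fourierIntegral_smul_eq_flip (μ := (volume : Measure E))
      (ν := (volume : Measure E)) (L := -innerₗ E) Real.continuous_fourierChar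
      (continuous_inner (𝕜 := ℝ) (E := E)).neg (f := G) (g := f) G.integrable hf
    rw [SchwartzMap.fourierInv_coe]
    convert! h using 4
    simp [Real.fourierInv_eq, VectorFourier.fourierIntegral, real_inner_comm]
  simpa [G] using hLp.symm.trans hL1

theorem norm_fourierInv_Lp_le {f : Lp F 2 (volume : Measure E)} (hf : Integrable f) :
    ∀ᵐ x, ‖(𝓕⁻ f : Lp F 2 (volume : Measure E)) x‖ ≤ ∫ ξ, ‖f ξ‖ := by
  filter_upwards [fourierInv_Lp_ae_eq hf] with x hx
  rw [hx, Real.fourierInv_eq]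
  refine (norm_integral_le_integral_norm _).trans (le_of_eq ?_)
  simp only [Circle.norm_smul]

theorem norm_fourierInv_Lp_eq (f : Lp F 2 (volume : Measure E)) :
    ‖(𝓕⁻ f : Lp F 2 (volume : Measure E))‖ = ‖f‖ :=
  (Lp.fourierTransformₗᵢ E F).symm.norm_map f

end FourierLp

theorem exists_eq_add_ae_eq_indicator {α G : Type*} [MeasurableSpace α] {μ : Measure α}
    [NormedAddCommGroup G] {p : ℝ≥0∞} (f : Lp G p μ) {S : Set α} (hS : MeasurableSet S) :
    ∃ f₁ f₂ : Lp G p μ, f = f₁ + f₂ ∧ f₁ =ᵐ[μ] S.indicator f ∧ f₂ =ᵐ[μ] Sᶜ.indicator f := by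
  have h₁ : MemLp (S.indicator f) p μ := (Lp.memLp f).indicator hS
  have h₂ : MemLp (Sᶜ.indicator f) p μ := (Lp.memLp f).indicator hS.compl
  refine ⟨h₁.toLp, h₂.toLp, ?_, h₁.coeFn_toLp, h₂.coeFn_toLp⟩
  rw [← MemLp.toLp_add h₁ h₂]
  simp only [Set.indicator_self_add_compl, Lp.toLp_coeFn]

section Embedding

variable {E F : Type*} [NormedAddCommGroup E] [InnerProductSpace ℝ E] [FiniteDimensional ℝ E]
  [MeasurableSpace E] [BorelSpace E] [NormedAddCommGroup F] [InnerProductSpace ℂ F]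

theorem eLpNorm_two_sq {α G : Type*} [MeasurableSpace α] [NormedAddCommGroup G] {μ : Measure α}
    (f : α → G) : eLpNorm f 2 μ ^ 2 = ∫⁻ x, ‖f x‖ₑ ^ 2 ∂μ := by
  simpa using eLpNorm_nnreal_pow_eq_lintegral (p := 2) (μ := μ) (f := f) (by norm_num)

theorem setIntegral_ball_norm_rpow {A : ℝ} (hA : 0 < A) (q : ℝ) :
    ∫ ξ : E in Metric.ball 0 A, ‖ξ‖ ^ q
      = A ^ (Module.finrank ℝ E + q) * ∫ ξ : E in Metric.ball 0 1, ‖ξ‖ ^ q := by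
  have hscale := Measure.setIntegral_comp_smul_of_pos (volume : Measure E) (fun ξ => ‖ξ‖ ^ q)
    (Metric.ball 0 1) hA
  simp only [smul_unitBall_of_pos hA, norm_smul, Real.norm_of_nonneg hA.le,
    Real.mul_rpow hA.le (norm_nonneg _), integral_const_mul, smul_eq_mul] at hscale
  rw [Real.rpow_add hA, Real.rpow_natCast, mul_assoc, hscale, mul_inv_cancel_left₀ (by positivity)]

theorem integrableOn_ball_norm_rpow [Nontrivial E] {q : ℝ} (hq : -Module.finrank ℝ E < q) (A : ℝ) :
    IntegrableOn (fun ξ : E => ‖ξ‖ ^ q) (Metric.ball 0 A) := by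
  refine integrableOn_ball_of_norm_le_rpow (C := 1) (α := -q) Module.finrank_pos (by linarith)
    (Eventually.of_forall fun ξ => ?_)
    (measurable_norm.pow_const q).aestronglyMeasurable
  rw [neg_neg, one_mul, Real.norm_of_nonneg (by positivity)]

theorem memLp_two_ball_norm_rpow [Nontrivial E] {q : ℝ} (hq : -Module.finrank ℝ E < 2 * q) (A : ℝ) :
    MemLp (fun ξ : E => ‖ξ‖ ^ q) 2 (volume.restrict (Metric.ball 0 A)) := by
  rw [memLp_two_iff_integrable_sq (measurable_norm.pow_const q).aestronglyMeasurable]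
  refine (integrableOn_ball_norm_rpow hq A).congr (.of_forall fun ξ => ?_)
  simp only [mul_comm 2 q, Real.rpow_mul (norm_nonneg ξ), Real.rpow_two]

theorem exists_setIntegral_ball_norm_le [Nontrivial E] {f : E → F} {s : ℝ}
    (hs : 2 * s < Module.finrank ℝ E) (hf : AEStronglyMeasurable f)
    (hsf : MemLp (fun ξ => ((‖ξ‖ ^ s : ℝ) : ℂ) • f ξ) 2) :
    ∃ C > 0, ∀ A > 0, IntegrableOn f (Metric.ball 0 A) ∧
      ∫ ξ in Metric.ball 0 A, ‖f ξ‖ ≤ C * A ^ (Module.finrank ℝ E / 2 - s) := by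
  set I : ℝ := ∫ ξ : E in Metric.ball 0 1, ‖ξ‖ ^ (-2 * s)
  set J : ℝ := ∫ ξ, ‖((‖ξ‖ ^ s : ℝ) : ℂ) • f ξ‖ ^ (2 : ℝ)
  have hI : 0 ≤ I := integral_nonneg fun ξ => by positivity
  have : 0 ≤ J := integral_nonneg fun ξ => by positivity
  refine ⟨I ^ (1 / 2 : ℝ) * J ^ (1 / 2 : ℝ) + 1, by positivity, fun A hA => ?_⟩
  have weight_sq (ξ : E) : (‖ξ‖ ^ (-s)) ^ (2 : ℝ) = ‖ξ‖ ^ (-2 * s) := by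
    rw [← Real.rpow_mul (norm_nonneg ξ)]; ring_nf
  have memLp_weight := memLp_two_ball_norm_rpow (E := E) (q := -s) (by linarith) A
  have memLp_norm := hsf.norm.restrict (Metric.ball (0 : E) A)
  have factor : (fun ξ : E => ‖ξ‖ ^ (-s) * ‖((‖ξ‖ ^ s : ℝ) : ℂ) • f ξ‖)
      =ᵐ[volume.restrict (Metric.ball 0 A)] fun ξ => ‖f ξ‖ := by
    filter_upwards [ae_restrict_of_ae (Measure.ae_ne volume (0 : E))] with ξ hξ
    have hpos : 0 < ‖ξ‖ := norm_pos_iff.2 hξ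
    rw [norm_smul, Complex.norm_real, Real.norm_of_nonneg (by positivity), ← mul_assoc,
      ← Real.rpow_add hpos, neg_add_cancel, Real.rpow_zero, one_mul]
  refine ⟨(integrable_norm_iff hf.restrict).1 ((memLp_weight.integrable_mul memLp_norm).congr
    factor), ?_⟩
  calc
    ∫ ξ in Metric.ball 0 A, ‖f ξ‖
      ≤ (∫ ξ : E in Metric.ball 0 A, (‖ξ‖ ^ (-s)) ^ (2 : ℝ)) ^ (1 / 2 : ℝ)
        * (∫ ξ in Metric.ball 0 A, ‖((‖ξ‖ ^ s : ℝ) : ℂ) • f ξ‖ ^ (2 : ℝ)) ^ (1 / 2 : ℝ) := by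
      rw [← integral_congr_ae factor]
      exact integral_mul_le_Lp_mul_Lq_of_nonneg Real.HolderConjugate.two_two
        (Eventually.of_forall fun ξ => by positivity) (Eventually.of_forall fun ξ => norm_nonneg _)
        (by simpa using memLp_weight) (by simpa using memLp_norm)
    _ ≤ (A ^ (Module.finrank ℝ E + -2 * s) * I) ^ (1 / 2 : ℝ) * J ^ (1 / 2 : ℝ) := by
      simp only [weight_sq, setIntegral_ball_norm_rpow hA]
      gcongr
      refine setIntegral_le_integral ?_ (Eventually.of_forall fun ξ => by positivity)
      simpa only [Real.rpow_two] using hsf.norm.integrable_sq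
    _ = I ^ (1 / 2 : ℝ) * J ^ (1 / 2 : ℝ) * A ^ (Module.finrank ℝ E / 2 - s) := by
      rw [Real.mul_rpow (by positivity) hI, ← Real.rpow_mul hA.le]
      ring_nf
    _ ≤ _ := by gcongr; linarith

variable [CompleteSpace F]

theorem measure_lt_norm_fourierInv_le (f : Lp F 2 (volume : Measure E)) {S : Set E}
    (hS : MeasurableSet S) {t : ℝ} (ht : 0 < t) (hint : IntegrableOn f S)
    (hle : ∫ ξ in S, ‖f ξ‖ ≤ t / 2) :
    volume {x | t < ‖(𝓕⁻ f : Lp F 2 (volume : Measure E)) x‖}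
      ≤ ENNReal.ofReal (t ^ (-2 : ℝ)) * ∫⁻ ξ in Sᶜ, 4 * ‖f ξ‖ₑ ^ 2 := by
  obtain ⟨low, high, hf, hlow, hhigh⟩ := exists_eq_add_ae_eq_indicator f hS
  have low_integrable : Integrable low := ((integrable_indicator_iff hS).2 hint).congr hlow.symm
  have low_small : ∫ ξ, ‖low ξ‖ ≤ t / 2 := by
    refine le_of_eq_of_le ?_ hle
    rw [← integral_indicator hS]
    refine integral_congr_ae (hlow.mono fun ξ h => ?_)
    simp only [h, norm_indicator_eq_indicator_norm]
  have high_large : volume {x | t < ‖(𝓕⁻ f : Lp F 2 (volume : Measure E)) x‖}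
      ≤ volume {x | ENNReal.ofReal (t / 2) ≤ ‖(𝓕⁻ high : Lp F 2 (volume : Measure E)) x‖ₑ} := by
    refine measure_mono_ae ?_
    filter_upwards [norm_fourierInv_Lp_le low_integrable,
      Lp.coeFn_add (𝓕⁻ low : Lp F 2 (volume : Measure E)) (𝓕⁻ high)] with x hx hadd
      (htx : t < ‖(𝓕⁻ f : Lp F 2 (volume : Measure E)) x‖)
    rw [hf, FourierTransform.fourierInv_add, hadd, Pi.add_apply] at htx
    change ENNReal.ofReal (t / 2) ≤ _
    rw [← ofReal_norm]
    exact ENNReal.ofReal_le_ofReal (by linarith [htx.trans_le (norm_add_le _ _)])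
  have plancherel : eLpNorm (𝓕⁻ high : Lp F 2 (volume : Measure E)) 2 volume ^ 2
      = ∫⁻ ξ in Sᶜ, ‖f ξ‖ₑ ^ 2 := by
    rw [← Lp.enorm_def, ← ofReal_norm, norm_fourierInv_Lp_eq, ofReal_norm, Lp.enorm_def,
      eLpNorm_congr_ae hhigh, eLpNorm_indicator_eq_eLpNorm_restrict hS.compl, eLpNorm_two_sq]
  have chebyshev := meas_ge_le_mul_pow_eLpNorm_enorm volume two_ne_zero ENNReal.ofNat_ne_top
    (Lp.aestronglyMeasurable (𝓕⁻ high : Lp F 2 (volume : Measure E)))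
    (ENNReal.ofReal_pos.2 (half_pos ht)).ne' fun h => absurd h ENNReal.ofReal_ne_top
  simp only [ENNReal.toReal_ofNat, ENNReal.rpow_two, plancherel] at chebyshev
  refine (high_large.trans chebyshev).trans_eq ?_
  rw [lintegral_const_mul' _ _ (by norm_num), ← mul_assoc,
    ← ENNReal.ofReal_inv_of_pos (half_pos ht), ← ENNReal.ofReal_pow (by positivity),
    ← ENNReal.ofReal_ofNat 4, ← ENNReal.ofReal_mul (by positivity), Real.rpow_neg ht.le,
    Real.rpow_two]
  congr 2
  field_simp
  norm_num

theorem exists_measure_lt_norm_fourierInv_le [Nontrivial E] {f : Lp F 2 (volume : Measure E)}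
    {s : ℝ} (hs : 2 * s < Module.finrank ℝ E)
    (hsf : MemLp (fun ξ => ((‖ξ‖ ^ s : ℝ) : ℂ) • f ξ) 2) :
    ∃ C > 0, ∀ t > 0, volume {x | t < ‖(𝓕⁻ f : Lp F 2 (volume : Measure E)) x‖}
      ≤ ENNReal.ofReal (t ^ (-2 : ℝ))
        * ∫⁻ ξ in {ξ | t ≤ C * ‖ξ‖ ^ (Module.finrank ℝ E / 2 - s)}, 4 * ‖f ξ‖ₑ ^ 2 := by
  obtain ⟨C, hC, hlow⟩ := exists_setIntegral_ball_norm_le hs (Lp.aestronglyMeasurable f) hsf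
  refine ⟨2 * C, by positivity, fun t ht => ?_⟩
  have hβ : 0 < Module.finrank ℝ E / 2 - s := by linarith
  set β : ℝ := Module.finrank ℝ E / 2 - s
  -- The radius for which the low frequencies contribute at most `t / 2`.
  set A : ℝ := (t / (2 * C)) ^ β⁻¹
  have hAβ : A ^ β = t / (2 * C) := Real.rpow_inv_rpow (by positivity) hβ.ne'
  have hball : {ξ : E | t ≤ 2 * C * ‖ξ‖ ^ β} = (Metric.ball 0 A)ᶜ := by
    ext ξ
    rw [Set.mem_compl_iff, mem_ball_zero_iff, not_lt, Set.mem_ofPred_eq,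
      ← Real.rpow_le_rpow_iff (by positivity) (norm_nonneg ξ) hβ, hAβ,
      div_le_iff₀' (by positivity)]
  obtain ⟨hint, hle⟩ := hlow A (by positivity)
  rw [hball]
  refine measure_lt_norm_fourierInv_le f Metric.isOpen_ball.measurableSet ht hint
    (hle.trans_eq ?_)
  rw [hAβ]
  field_simp

theorem memLp_fourierInv [Nontrivial E] {f : Lp F 2 (volume : Measure E)} {s : ℝ} (hs0 : 0 < s)
    (hs : 2 * s < Module.finrank ℝ E) (hsf : MemLp (fun ξ => ((‖ξ‖ ^ s : ℝ) : ℂ) • f ξ) 2) :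
    MemLp (𝓕⁻ f : Lp F 2 (volume : Measure E))
      (ENNReal.ofReal (2 * Module.finrank ℝ E / (Module.finrank ℝ E - 2 * s))) := by
  obtain ⟨C, hC, hlevel⟩ := exists_measure_lt_norm_fourierInv_le hs hsf
  set d : ℝ := (Module.finrank ℝ E : ℝ)
  set p : ℝ := 2 * d / (d - 2 * s) with hp
  have hd : 0 < d - 2 * s := by linarith
  have hβp : (d / 2 - s) * (p - 2) = 2 * s := by rw [hp]; field_simp; ring
  have hp2 : 2 < p := by nlinarith
  have weight (ξ : E) : ENNReal.ofReal ((C * ‖ξ‖ ^ (d / 2 - s)) ^ (p - 2)) * (4 * ‖f ξ‖ₑ ^ 2)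
      = ENNReal.ofReal (C ^ (p - 2) * 4) * ‖((‖ξ‖ ^ s : ℝ) : ℂ) • f ξ‖ₑ ^ 2 := by
    rw [Real.mul_rpow hC.le (by positivity), ← Real.rpow_mul (norm_nonneg ξ), hβp, two_mul,
      enorm_smul, mul_pow, ← ofReal_norm (_ : ℂ), Complex.norm_real,
      Real.norm_of_nonneg (by positivity), ← ENNReal.ofReal_pow (by positivity),
      ← Real.rpow_mul_natCast (norm_nonneg ξ), ENNReal.ofReal_mul (by positivity),
      ENNReal.ofReal_mul (by positivity), ENNReal.ofReal_ofNat, Nat.cast_ofNat, mul_two]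
    ring
  have hbound := lintegral_rpow_le_of_measure_lt_le (by linarith) hp2
    (Eventually.of_forall fun x => norm_nonneg _) (Lp.aestronglyMeasurable _).norm.aemeasurable
    (((Lp.aestronglyMeasurable f).enorm.pow_const 2).const_mul 4) (by fun_prop)
    (fun ξ => by positivity) hlevel
  simp only [weight, lintegral_const_mul' _ _ ENNReal.ofReal_ne_top, ← eLpNorm_two_sq] at hbound
  refine ⟨Lp.aestronglyMeasurable _, ?_⟩
  rw [eLpNorm_lt_top_iff_lintegral_rpow_enorm_lt_top
    (ENNReal.ofReal_pos.2 (by linarith)).ne' ENNReal.ofReal_ne_top,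
    ENNReal.toReal_ofReal (by linarith)]
  have hp0 : 0 ≤ p := by linarith
  simp only [← ofReal_norm, ENNReal.ofReal_rpow_of_nonneg (norm_nonneg _) hp0]
  refine hbound.trans_lt (ENNReal.mul_lt_top ENNReal.ofReal_lt_top
    (ENNReal.mul_lt_top ENNReal.ofReal_lt_top (ENNReal.pow_lt_top hsf.eLpNorm_lt_top)))

end Embedding

section Dilation

variable {E F : Type*} [NormedAddCommGroup E] [NormedSpace ℝ E] [FiniteDimensional ℝ E]
  [MeasurableSpace E] [BorelSpace E] [NormedAddCommGroup F]

theorem ae_comp_smul (μ : Measure E) [μ.IsAddHaarMeasure] {c : ℝ} (hc : c ≠ 0) {P : E → Prop}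
    (h : ∀ᵐ x ∂μ, P x) : ∀ᵐ x ∂μ, P (c • x) :=
  (Measure.quasiMeasurePreserving_smul μ hc).ae h

theorem eLpNorm_comp_smul {μ : Measure E} [μ.IsAddHaarMeasure] {c : ℝ} (hc : c ≠ 0) {f : E → F}
    (hf : AEStronglyMeasurable f μ) (p : ℝ≥0∞) :
    eLpNorm (fun x => f (c • x)) p μ =
      ENNReal.ofReal |(c ^ Module.finrank ℝ E)⁻¹| ^ (1 / p).toReal * eLpNorm f p μ := by
  have hmap := Measure.map_addHaar_smul μ hc
  have hf' : AEStronglyMeasurable f (Measure.map (c • ·) μ) := by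
    rw [hmap]
    exact hf.smul_measure _
  have hpos : ENNReal.ofReal |(c ^ Module.finrank ℝ E)⁻¹| ≠ 0 :=
    (ENNReal.ofReal_pos.2 (abs_pos.2 (inv_ne_zero (pow_ne_zero _ hc)))).ne'
  rw [← smul_eq_mul, ← eLpNorm_smul_measure_of_ne_zero hpos, ← hmap,
    eLpNorm_map_measure hf' (measurable_const_smul c).aemeasurable, Function.comp_def]

theorem memLp_comp_smul {μ : Measure E} [μ.IsAddHaarMeasure] {c : ℝ} (hc : c ≠ 0) {f : E → F}
    {p : ℝ≥0∞} (hf : MemLp f p μ) : MemLp (fun x => f (c • x)) p μ := by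
  refine ⟨hf.1.comp_quasiMeasurePreserving (Measure.quasiMeasurePreserving_smul μ hc), ?_⟩
  rw [eLpNorm_comp_smul hc hf.1]
  exact ENNReal.mul_lt_top
    (ENNReal.rpow_lt_top_of_nonneg ENNReal.toReal_nonneg ENNReal.ofReal_ne_top) hf.2

/-- The dilation `f ↦ f(c ·)` as a bounded operator on `L^p`. -/
def dilation (𝕜 : Type*) [NontriviallyNormedField 𝕜] [NormedSpace 𝕜 F] (p : ℝ≥0∞) [Fact (1 ≤ p)]
    (μ : Measure E) [μ.IsAddHaarMeasure] {c : ℝ} (hc : c ≠ 0) : Lp F p μ →L[𝕜] Lp F p μ :=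
  LinearMap.mkContinuous
    { toFun := fun f => (memLp_comp_smul hc (Lp.memLp f)).toLp
      map_add' := fun f g => by
        rw [← MemLp.toLp_add, MemLp.toLp_eq_toLp_iff]
        exact ae_comp_smul μ hc (Lp.coeFn_add f g)
      map_smul' := fun a f => by
        rw [RingHom.id_apply, ← MemLp.toLp_const_smul, MemLp.toLp_eq_toLp_iff]
        exact ae_comp_smul μ hc (Lp.coeFn_smul a f) }
    (ENNReal.ofReal |(c ^ Module.finrank ℝ E)⁻¹| ^ (1 / p).toReal).toReal fun f => by
      rw [LinearMap.coe_mk, AddHom.coe_mk, Lp.norm_toLp,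
        eLpNorm_comp_smul hc (Lp.aestronglyMeasurable f), ENNReal.toReal_mul, Lp.norm_def]

theorem coeFn_dilation (𝕜 : Type*) [NontriviallyNormedField 𝕜] [NormedSpace 𝕜 F] {p : ℝ≥0∞}
    [Fact (1 ≤ p)] {μ : Measure E} [μ.IsAddHaarMeasure] {c : ℝ} (hc : c ≠ 0) (f : Lp F p μ) :
    dilation 𝕜 p μ hc f =ᵐ[μ] fun x => f (c • x) :=
  MemLp.coeFn_toLp (memLp_comp_smul hc (Lp.memLp f))

end Dilation

section FourierDilation

variable {E F : Type*} [NormedAddCommGroup E] [InnerProductSpace ℝ E] [FiniteDimensional ℝ E]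
  [MeasurableSpace E] [BorelSpace E] [NormedAddCommGroup F]

theorem fourier_comp_smul [NormedSpace ℂ F] {c : ℝ} (hc : c ≠ 0) (f : E → F) (ξ : E) :
    𝓕 (fun x => f (c • x)) ξ = |(c ^ Module.finrank ℝ E)⁻¹| • 𝓕 f (c⁻¹ • ξ) := by
  rw [Real.fourier_eq, Real.fourier_eq, ← Measure.integral_comp_smul volume _ c]
  simp only [inner_smul_left, inner_smul_right, conj_trivial, inv_mul_cancel_left₀ hc]

theorem dilation_toLp [NormedSpace ℂ F] {c : ℝ} (hc : c ≠ 0) (φ : SchwartzMap E F) :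
    dilation ℂ 2 volume hc (φ.toLp 2) =
      (SchwartzMap.compCLMOfContinuousLinearEquiv ℂ
        (ContinuousLinearEquiv.smulLeft (R₁ := ℝ) (Units.mk0 c hc)) φ).toLp 2 := by
  ext1
  refine (coeFn_dilation ℂ hc _).trans (EventuallyEq.trans ?_ (SchwartzMap.coeFn_toLp _ 2 _).symm)
  exact ae_comp_smul volume hc (φ.coeFn_toLp 2 volume)

theorem fourier_dilation [InnerProductSpace ℂ F] [CompleteSpace F] {c : ℝ} (hc : c ≠ 0)
    (f : Lp F 2 (volume : Measure E)) :
    𝓕 (dilation ℂ 2 volume hc f) =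
      |(c ^ Module.finrank ℝ E)⁻¹| • dilation ℂ 2 volume (inv_ne_zero hc) (𝓕 f) := by
  have hdense : DenseRange (SchwartzMap.toLpCLM ℂ (E := E) F 2 volume) :=
    SchwartzMap.denseRange_toLpCLM ENNReal.ofNat_ne_top
  refine hdense.induction_on (p := fun f => 𝓕 (dilation ℂ 2 volume hc f) =
    |(c ^ Module.finrank ℝ E)⁻¹| • dilation ℂ 2 volume (inv_ne_zero hc) (𝓕 f)) f
    (isClosed_eq ?_ ?_) fun φ => ?_
  · exact (Lp.fourierTransformₗᵢ E F).continuous.comp (dilation ℂ 2 volume hc).continuous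
  · exact ((dilation ℂ 2 volume (inv_ne_zero hc)).continuous.comp
      (Lp.fourierTransformₗᵢ E F).continuous).const_smul |(c ^ Module.finrank ℝ E)⁻¹|
  · rw [SchwartzMap.toLpCLM_apply, dilation_toLp, SchwartzMap.toLp_fourier_eq,
      SchwartzMap.toLp_fourier_eq, dilation_toLp]
    ext1
    refine (SchwartzMap.coeFn_toLp _ 2 _).trans (EventuallyEq.trans ?_ (Lp.coeFn_smul _ _).symm)
    filter_upwards [SchwartzMap.coeFn_toLp (SchwartzMap.compCLMOfContinuousLinearEquiv ℂ
      (ContinuousLinearEquiv.smulLeft (R₁ := ℝ) (Units.mk0 c⁻¹ (inv_ne_zero hc))) (𝓕 φ)) 2 volume]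
      with ξ hξ
    rw [Pi.smul_apply, hξ, SchwartzMap.fourier_coe]
    exact (fourier_comp_smul hc φ ξ).trans (by rw [← SchwartzMap.fourier_coe]; rfl)

end FourierDilation

section FractionalSobolev

variable {N : ℕ} {s : ℝ}

instance : CoeFun (Hs N s) fun _ => RN N → ℝ :=
  ⟨fun u => u.1⟩

theorem memLp_symbolMul (u : Hs N s) : MemLp (symbolMul s u.1) 2 volume :=
  u.2

theorem fourierL2_injective :
    Function.Injective (fourierL2 : Lp ℝ 2 (volume : Measure (RN N)) → _) := by
  intro u v huv
  have hcomp : Complex.ofRealCLM.compLp u = Complex.ofRealCLM.compLp v :=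
    (Lp.fourierTransformₗᵢ (RN N) ℂ).injective huv
  ext1
  filter_upwards [Complex.ofRealCLM.coeFn_compLp u, Complex.ofRealCLM.coeFn_compLp v]
    with x hu hv
  rw [hcomp, hv] at hu
  exact (Complex.ofReal_injective hu).symm

theorem fourierInv_fourierL2 (u : Lp ℝ 2 (volume : Measure (RN N))) :
    𝓕⁻ (fourierL2 u) = Complex.ofRealCLM.compLp u :=
  FourierTransform.fourierInv_fourier_eq _

theorem halfLap_eq_fourierInv (u : Hs N s) : halfLap u = 𝓕⁻ (memLp_symbolMul u).toLp :=
  rfl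

theorem fourier_halfLap (u : Hs N s) : 𝓕 (halfLap u) = (memLp_symbolMul u).toLp :=
  FourierTransform.fourier_fourierInv_eq _

theorem halfLap_add (u v : Hs N s) : halfLap (u + v) = halfLap u + halfLap v := by
  rw [halfLap_eq_fourierInv, halfLap_eq_fourierInv, halfLap_eq_fourierInv,
    ← FourierTransform.fourierInv_add, ← MemLp.toLp_add]
  congr 1
  rw [MemLp.toLp_eq_toLp_iff]
  filter_upwards [Lp.coeFn_add (fourierL2 u.1) (fourierL2 v.1)] with ξ hξ
  simp only [symbolMul, Pi.add_apply, Submodule.coe_add, fourierL2_add, hξ, mul_add]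

theorem halfLap_smul (c : ℝ) (u : Hs N s) : halfLap (c • u) = c • halfLap u := by
  rw [show c • halfLap u = (c : ℂ) • halfLap u from (algebraMap_smul ℂ c _).symm,
    halfLap_eq_fourierInv, halfLap_eq_fourierInv, ← FourierTransform.fourierInv_smul,
    ← MemLp.toLp_const_smul]
  congr 1
  rw [MemLp.toLp_eq_toLp_iff]
  filter_upwards [Lp.coeFn_smul (c : ℂ) (fourierL2 u.1)] with ξ hξ
  simp only [symbolMul, Submodule.coe_smul, fourierL2_smul, hξ, Pi.smul_apply, smul_eq_mul,
    mul_left_comm]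

theorem norm_sq_eq_integral {α F : Type*} [MeasurableSpace α] {μ : Measure α}
    [NormedAddCommGroup F] [InnerProductSpace ℝ F] (f : Lp F 2 μ) :
    ‖f‖ ^ 2 = ∫ x, ‖f x‖ ^ 2 ∂μ := by
  simp only [← real_inner_self_eq_norm_sq, L2.inner_def]

theorem kinetic_eq_norm_sq (u : Hs N s) : kinetic u = ‖halfLap u‖ ^ 2 :=
  (norm_sq_eq_integral _).symm

theorem kinetic_eq_integral_symbolMul (u : Hs N s) :
    kinetic u = ∫ ξ, ‖symbolMul s u.1 ξ‖ ^ 2 := by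
  rw [kinetic_eq_norm_sq, ← Lp.norm_fourier_eq, fourier_halfLap, norm_sq_eq_integral]
  refine integral_congr_ae ?_
  filter_upwards [(memLp_symbolMul u).coeFn_toLp] with ξ hξ
  rw [hξ]

theorem kineticForm_eq_inner (u φ : Hs N s) :
    kineticForm u φ = inner ℝ (halfLap u) (halfLap φ) :=
  (L2.inner_def _ _).symm

theorem mass_eq_norm_sq (u : Hs N s) : mass u = ‖u‖ ^ 2 := by
  simp only [mass, Submodule.coe_norm, norm_sq_eq_integral, Real.norm_eq_abs, sq_abs]

theorem integral_mul_eq_inner (v w : Lp ℝ 2 (volume : Measure (RN N))) :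
    ∫ x, v x * w x = inner ℝ v w := by
  simp only [L2.inner_def, Real.inner_apply]

theorem hasDerivAt_norm_add_smul_sq {V : Type*} [NormedAddCommGroup V] [InnerProductSpace ℝ V]
    (x y : V) : HasDerivAt (fun t : ℝ => ‖x + t • y‖ ^ 2) (2 * inner ℝ x y) 0 := by
  simpa using (((hasDerivAt_id (0 : ℝ)).smul_const y).const_add x).norm_sq

theorem hasDerivAt_kinetic (u φ : Hs N s) :
    HasDerivAt (fun t : ℝ => kinetic (u + t • φ)) (2 * kineticForm u φ) 0 := by
  simpa only [kinetic_eq_norm_sq, kineticForm_eq_inner, halfLap_add, halfLap_smul] using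
    hasDerivAt_norm_add_smul_sq (halfLap u) (halfLap φ)

theorem hasDerivAt_mass (u φ : Hs N s) :
    HasDerivAt (fun t : ℝ => mass (u + t • φ)) (2 * ∫ x, u x * φ x) 0 := by
  simpa only [mass_eq_norm_sq, integral_mul_eq_inner, Submodule.coe_inner] using
    hasDerivAt_norm_add_smul_sq u φ

theorem kinetic_nonneg (u : Hs N s) : 0 ≤ kinetic u :=
  integral_nonneg fun _ => by positivity

theorem mass_zero : mass (0 : Hs N s) = 0 := by
  simp [mass_eq_norm_sq]

theorem mass_pos {u : Hs N s} (hu : u ≠ 0) : 0 < mass u := by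
  have := norm_pos_iff.2 hu
  rw [mass_eq_norm_sq]
  positivity

theorem kinetic_pos (hN : N ≠ 0) {u : Hs N s} (hu : u ≠ 0) : 0 < kinetic u := by
  have : NeZero N := ⟨hN⟩
  refine (kinetic_nonneg u).lt_of_ne' fun h => hu (Subtype.ext (fourierL2_injective ?_))
  have hsymbol : symbolMul s u.1 =ᵐ[volume] 0 := by
    have hint := (integral_eq_zero_iff_of_nonneg (fun ξ => by positivity)
      (memLp_symbolMul u).norm.integrable_sq).1 ((kinetic_eq_integral_symbolMul u).symm.trans h)
    filter_upwards [hint] with ξ hξ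
    simpa using hξ
  rw [Submodule.coe_zero, fourierL2_zero, Lp.eq_zero_iff_ae_eq_zero]
  filter_upwards [hsymbol, Measure.ae_ne volume (0 : RN N)] with ξ hξ hξ0
  have hpos : 0 < 2 * Real.pi * ‖ξ‖ := by
    have := norm_pos_iff.2 hξ0
    positivity
  simpa [symbolMul, (Real.rpow_pos_of_pos hpos s).ne'] using hξ

theorem ne_zero_of_two_mul_lt (hs0 : 0 < s) (hN : 2 * s < N) : N ≠ 0 := by
  rintro rfl
  norm_num at hN
  linarith

theorem critExp_gt_two (hs0 : 0 < s) (hN : 2 * s < N) : 2 < critExp N s := by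
  rw [critExp, lt_div_iff₀ (by linarith)]
  linarith

theorem memLp_critExp (hs0 : 0 < s) (hN : 2 * s < N) (u : Hs N s) :
    MemLp u (ENNReal.ofReal (critExp N s)) := by
  have hN0 : NeZero N := ⟨ne_zero_of_two_mul_lt hs0 hN⟩
  have hsymbol : MemLp (fun ξ : RN N => ((‖ξ‖ ^ s : ℝ) : ℂ) • fourierL2 u.1 ξ) 2 := by
    refine ((memLp_symbolMul u).const_smul ((2 * Real.pi) ^ (-s))).ae_eq (.of_forall fun ξ => ?_)
    simp only [symbolMul, Pi.smul_apply, Complex.real_smul, smul_eq_mul, ← mul_assoc,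
      ← Complex.ofReal_mul, Real.mul_rpow Real.two_pi_pos.le (norm_nonneg ξ)]
    rw [Real.rpow_neg Real.two_pi_pos.le, inv_mul_cancel₀ (by positivity), one_mul]
  have hmem := memLp_fourierInv hs0 (by rwa [finrank_euclideanSpace_fin]) hsymbol
  rw [fourierInv_fourierL2, finrank_euclideanSpace_fin, ← critExp] at hmem
  refine hmem.of_le (Lp.aestronglyMeasurable _) ?_
  filter_upwards [Complex.ofRealCLM.coeFn_compLp u.1] with x hx
  rw [hx, Complex.ofRealCLM_apply, Complex.norm_real]

theorem integrable_abs_rpow_critExp (hs0 : 0 < s) (hN : 2 * s < N) (u : Hs N s) :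
    Integrable fun x => |u x| ^ critExp N s := by
  have hcrit : 0 < critExp N s := by linarith [critExp_gt_two hs0 hN]
  have hint := (memLp_critExp hs0 hN u).integrable_norm_rpow (ENNReal.ofReal_pos.2 hcrit).ne'
    ENNReal.ofReal_ne_top
  rwa [ENNReal.toReal_ofReal hcrit.le] at hint

end FractionalSobolev

section SchwartzAndDilation

variable {N : ℕ} {s : ℝ}

theorem rpow_le_one_add_sq_pow {x : ℝ} (hx : 0 ≤ x) (hs : 0 ≤ s) :
    x ^ s ≤ (1 + x ^ 2) ^ ⌈s⌉₊ := by
  rcases le_total x 1 with hx1 | hx1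
  · exact (Real.rpow_le_one hx hx1 hs).trans (one_le_pow₀ (by nlinarith))
  · calc x ^ s ≤ x ^ (⌈s⌉₊ : ℝ) := Real.rpow_le_rpow_of_exponent_le hx1 (Nat.le_ceil s)
      _ = x ^ ⌈s⌉₊ := Real.rpow_natCast x _
      _ ≤ (1 + x ^ 2) ^ ⌈s⌉₊ := by gcongr; nlinarith

theorem fourierL2_toLp (φ : SchwartzMap (RN N) ℝ) :
    fourierL2 (φ.toLp 2) = (𝓕 (φ.postcompCLM Complex.ofRealCLM)).toLp 2 :=
  SchwartzMap.toLp_fourier_eq (φ.postcompCLM Complex.ofRealCLM)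

theorem schwartz_mem_Hs (hs : 0 ≤ s) (φ : SchwartzMap (RN N) ℝ) :
    φ.toLp 2 (volume : Measure (RN N)) ∈ Hs N s := by
  set ψ := 𝓕 (φ.postcompCLM Complex.ofRealCLM)
  set w : RN N → ℝ := fun ξ => (1 + (2 * Real.pi) ^ 2 * ‖ξ‖ ^ 2) ^ ⌈s⌉₊
  have hw : w.HasTemperateGrowth := by fun_prop
  have hmeas : AEStronglyMeasurable (symbolMul s (φ.toLp 2 (volume : Measure (RN N)))) volume :=
    (Measurable.aestronglyMeasurable (by fun_prop)).mul (Lp.aestronglyMeasurable _)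
  refine ((SchwartzMap.smulLeftCLM ℂ w ψ).memLp 2 volume).mono hmeas ?_
  filter_upwards [ψ.coeFn_toLp 2 volume] with ξ hξ
  rw [SchwartzMap.smulLeftCLM_apply_apply hw, symbolMul, fourierL2_toLp, hξ, norm_mul, norm_smul,
    Complex.norm_real, Real.norm_of_nonneg (by positivity), Real.norm_of_nonneg (by positivity)]
  simp only [w, ← mul_pow]
  gcongr
  exact rpow_le_one_add_sq_pow (by positivity) hs

theorem exists_integrable_integral_mul_ne_zero (hs : 0 ≤ s)
    {w : Lp ℝ 2 (volume : Measure (RN N))} (hw : w ≠ 0) :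
    ∃ φ : Hs N s, Integrable φ ∧ ∫ x, w x * φ x ≠ 0 := by
  by_contra! hall
  have hdense : DenseRange (SchwartzMap.toLpCLM ℝ (E := RN N) ℝ 2 volume) :=
    SchwartzMap.denseRange_toLpCLM ENNReal.ofNat_ne_top
  have horth : ∀ v : Lp ℝ 2 (volume : Measure (RN N)), inner ℝ w v = 0 := fun v =>
    hdense.induction_on (p := fun v => inner ℝ w v = 0) v
      (isClosed_eq (by fun_prop) continuous_const) fun φ => by
        rw [← integral_mul_eq_inner]
        exact hall ⟨_, schwartz_mem_Hs hs φ⟩ (φ.integrable.congr (φ.coeFn_toLp 2 volume).symm)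
  exact hw (inner_self_eq_zero.1 (horth w))

theorem ofReal_compLp_dilation {c : ℝ} (hc : c ≠ 0) (u : Lp ℝ 2 (volume : Measure (RN N))) :
    Complex.ofRealCLM.compLp (dilation ℝ 2 volume hc u) =
      dilation ℂ 2 volume hc (Complex.ofRealCLM.compLp u) := by
  ext1
  filter_upwards [Complex.ofRealCLM.coeFn_compLp (dilation ℝ 2 volume hc u),
    coeFn_dilation ℝ hc u, coeFn_dilation ℂ hc (Complex.ofRealCLM.compLp u),
    ae_comp_smul volume hc (Complex.ofRealCLM.coeFn_compLp u)] with x h1 h2 h3 h4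
  rw [h1, h2, h3, h4]

theorem symbolMul_dilation_ae_eq {r : ℝ} (hr : 0 < r) (u : Lp ℝ 2 (volume : Measure (RN N))) :
    symbolMul s (dilation ℝ 2 volume (inv_ne_zero hr.ne') u) =ᵐ[volume]
      fun ξ => r ^ (N - s) • symbolMul s u (r • ξ) := by
  have hfourier : fourierL2 (dilation ℝ 2 volume (inv_ne_zero hr.ne') u) =
      r ^ N • dilation ℂ 2 volume (inv_ne_zero (inv_ne_zero hr.ne')) (fourierL2 u) := by
    rw [fourierL2, ofReal_compLp_dilation, fourier_dilation, finrank_euclideanSpace_fin, inv_pow,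
      inv_inv, abs_of_pos (by positivity), fourierL2]
  have hpow (ξ : RN N) : (2 * Real.pi * ‖ξ‖) ^ s * r ^ N =
      r ^ (N - s) * (2 * Real.pi * ‖r • ξ‖) ^ s := by
    rw [norm_smul, Real.norm_of_nonneg hr.le, mul_left_comm, Real.mul_rpow hr.le (by positivity),
      ← mul_assoc, ← Real.rpow_add hr, sub_add_cancel, Real.rpow_natCast, mul_comm]
  filter_upwards [Lp.coeFn_smul (r ^ N) (dilation ℂ 2 volume (inv_ne_zero (inv_ne_zero hr.ne'))
    (fourierL2 u)), coeFn_dilation ℂ (inv_ne_zero (inv_ne_zero hr.ne')) (fourierL2 u)]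
    with ξ hsmul hdil
  rw [symbolMul, symbolMul, hfourier, hsmul, Pi.smul_apply, hdil, inv_inv, Complex.real_smul,
    Complex.real_smul, ← mul_assoc, ← mul_assoc, ← Complex.ofReal_mul, ← Complex.ofReal_mul, hpow]

/-- The spatial rescaling `u(· / r)`, which stretches the graph of `u` by the factor `r`. -/
def rescale {r : ℝ} (hr : 0 < r) (u : Hs N s) : Hs N s :=
  ⟨dilation ℝ 2 volume (inv_ne_zero hr.ne') u.1,
    ((memLp_comp_smul hr.ne' (memLp_symbolMul u)).const_smul (r ^ (N - s))).ae_eq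
      (symbolMul_dilation_ae_eq hr u.1).symm⟩

theorem coeFn_rescale {r : ℝ} (hr : 0 < r) (u : Hs N s) :
    (rescale hr u : RN N → ℝ) =ᵐ[volume] fun x => u (r⁻¹ • x) :=
  coeFn_dilation ℝ _ _

theorem kinetic_rescale {r : ℝ} (hr : 0 < r) (u : Hs N s) :
    kinetic (rescale hr u) = r ^ (N - 2 * s) * kinetic u := by
  have hpow : (r ^ (N - s)) ^ 2 * (r ^ N)⁻¹ = r ^ (N - 2 * s) := by
    rw [← Real.rpow_mul_natCast hr.le, ← Real.rpow_natCast, ← Real.rpow_neg hr.le,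
      ← Real.rpow_add hr]
    ring_nf
  calc kinetic (rescale hr u)
      = ∫ ξ, (r ^ (N - s)) ^ 2 * ‖symbolMul s u.1 (r • ξ)‖ ^ 2 := by
        rw [kinetic_eq_integral_symbolMul]
        refine integral_congr_ae ?_
        filter_upwards [symbolMul_dilation_ae_eq hr u.1] with ξ hξ
        rw [rescale, hξ, norm_smul, mul_pow, Real.norm_of_nonneg (by positivity)]
    _ = r ^ (N - 2 * s) * kinetic u := by
        rw [integral_const_mul, Measure.integral_comp_smul volume (‖symbolMul s u.1 ·‖ ^ 2) r,
          finrank_euclideanSpace_fin, abs_of_pos (by positivity), smul_eq_mul, ← mul_assoc, hpow,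
          kinetic_eq_integral_symbolMul]

theorem integral_comp_rescale {r : ℝ} (hr : 0 < r) (u : Hs N s) (F : ℝ → ℝ) :
    ∫ x, F (rescale hr u x) = r ^ N * ∫ x, F (u x) := by
  have hcomp : (fun x => F (rescale hr u x)) =ᵐ[volume] fun x => F (u (r⁻¹ • x)) := by
    filter_upwards [coeFn_rescale hr u] with x hx
    rw [hx]
  rw [integral_congr_ae hcomp, Measure.integral_comp_smul volume (fun x => F (u x)) r⁻¹,
    finrank_euclideanSpace_fin, inv_pow, inv_inv, abs_of_pos (by positivity), smul_eq_mul]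

theorem integrable_comp_rescale {r : ℝ} (hr : 0 < r) (u : Hs N s) {F : ℝ → ℝ}
    (h : Integrable fun x => F (u x)) : Integrable fun x => F (rescale hr u x) := by
  refine (h.comp_smul (inv_ne_zero hr.ne')).congr ?_
  filter_upwards [coeFn_rescale hr u] with x hx
  rw [hx]

theorem mass_rescale {r : ℝ} (hr : 0 < r) (u : Hs N s) :
    mass (rescale hr u) = r ^ N * mass u :=
  integral_comp_rescale hr u (· ^ 2)

end SchwartzAndDilation

section Nonlinearity

variable {N : ℕ} {s : ℝ} {g : ℝ → ℝ}

theorem hasDerivAt_primitive (hg : Continuous g) (t : ℝ) : HasDerivAt (primitive g) (g t) t :=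
  intervalIntegral.integral_hasDerivAt_right (hg.intervalIntegrable _ _)
    hg.aestronglyMeasurable.stronglyMeasurableAtFilter hg.continuousAt

theorem continuous_primitive (hg : Continuous g) : Continuous (primitive g) :=
  continuous_iff_continuousAt.2 fun t => (hasDerivAt_primitive hg t).continuousAt

theorem primitive_zero (g : ℝ → ℝ) : primitive g 0 = 0 :=
  intervalIntegral.integral_same

theorem exists_abs_le_of_condG2 (hg : Continuous g) (hg2 : CondG2 N s g) :
    ∃ C ≥ 0, ∀ t, |g t| ≤ C * (1 + |t| ^ (critExp N s - 1)) := by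
  obtain ⟨c, hc, -⟩ := EReal.lt_iff_exists_real_btwn.1 hg2
  obtain ⟨R, hR⟩ := eventually_atTop.1 (eventually_comap.1 (eventually_lt_of_limsup_lt hc))
  obtain ⟨D, hD⟩ := (isCompact_Icc (a := -(max R 1)) (b := max R 1)).exists_bound_of_continuousOn
    hg.continuousOn
  refine ⟨max c (max D 0), by positivity, fun t => ?_⟩
  rcases le_total |t| (max R 1) with ht | ht
  · calc |g t| ≤ max c (max D 0) * 1 := by
          rw [mul_one]
          exact (hD t (abs_le.1 ht)).trans ((le_max_left _ _).trans (le_max_right _ _))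
      _ ≤ max c (max D 0) * (1 + |t| ^ (critExp N s - 1)) := by
          gcongr
          exact le_add_of_nonneg_right (by positivity)
  · have ht0 : 0 < |t| := one_pos.trans_le ((le_max_right R 1).trans ht)
    have hquot : |g t| / |t| ^ (critExp N s - 1) < c := by
      exact_mod_cast hR |t| ((le_max_left _ _).trans ht) t rfl
    calc |g t| ≤ c * |t| ^ (critExp N s - 1) := ((div_lt_iff₀ (by positivity)).1 hquot).le
      _ ≤ max c (max D 0) * (1 + |t| ^ (critExp N s - 1)) := by
          gcongr
          · exact le_max_left _ _
          · exact le_add_of_nonneg_left zero_le_one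

theorem exists_mul_le_sq_of_condG1 (hg1 : CondG1 g) :
    ∃ δ > 0, ∀ t, |t| < δ → t * g t ≤ t ^ 2 := by
  have hlim : limsup (fun t : ℝ => ((g t / t : ℝ) : EReal)) (𝓝[≠] 0) < ((1 : ℝ) : EReal) :=
    hg1.trans_lt (by norm_num)
  obtain ⟨δ, hδ, hquot⟩ := Metric.eventually_nhds_iff.1
    (eventually_nhdsWithin_iff.1 (eventually_lt_of_limsup_lt hlim))
  refine ⟨δ, hδ, fun t ht => ?_⟩
  rcases eq_or_ne t 0 with rfl | ht0
  · simp
  · have hlt : g t / t < 1 := by exact_mod_cast hquot (by simpa using ht) ht0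
    calc t * g t = t ^ 2 * (g t / t) := by field_simp
      _ ≤ t ^ 2 := mul_le_of_le_one_right (sq_nonneg t) hlt.le

theorem primitive_eq_integral_unitInterval (g : ℝ → ℝ) (t : ℝ) :
    primitive g t = ∫ θ in (0 : ℝ)..1, t * g (t * θ) := by
  rw [intervalIntegral.integral_const_mul, intervalIntegral.mul_integral_comp_mul_left, mul_zero,
    mul_one, primitive]

theorem primitive_le_of_mul_le_sq (hg : Continuous g) {δ : ℝ}
    (hle : ∀ t, |t| < δ → t * g t ≤ t ^ 2) {t : ℝ} (ht : |t| < δ) :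
    primitive g t ≤ t ^ 2 / 2 := by
  have hpoint : ∀ θ ∈ Set.Ioo (0 : ℝ) 1, t * g (t * θ) ≤ t ^ 2 * θ := fun θ hθ => by
    have hsmall : |t * θ| < δ := by
      rw [abs_mul, abs_of_pos hθ.1]
      exact (mul_le_of_le_one_right (abs_nonneg t) hθ.2.le).trans_lt ht
    refine le_of_mul_le_mul_left ?_ hθ.1
    linarith [hle _ hsmall]
  calc primitive g t = ∫ θ in (0 : ℝ)..1, t * g (t * θ) := primitive_eq_integral_unitInterval g t
    _ ≤ ∫ θ in (0 : ℝ)..1, t ^ 2 * θ :=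
        intervalIntegral.integral_mono_on_of_le_Ioo zero_le_one
          (Continuous.intervalIntegrable (by fun_prop) _ _)
          (Continuous.intervalIntegrable (by fun_prop) _ _) hpoint
    _ = t ^ 2 / 2 := by
        rw [intervalIntegral.integral_const_mul, integral_id]
        ring

theorem abs_primitive_sub_le (hg : Continuous g) {C q : ℝ} (hC : 0 ≤ C) (hq : 0 ≤ q)
    (hle : ∀ t, |g t| ≤ C * (1 + |t| ^ q)) (a b : ℝ) :
    |primitive g (a + b) - primitive g a| ≤ C * (1 + (|a| + |b|) ^ q) * |b| := by
  have hbound : ∀ x ∈ Set.uIcc a (a + b), ‖g x‖ ≤ C * (1 + (|a| + |b|) ^ q) := fun x hx => by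
    have hxa : |x - a| ≤ |b| := by simpa using Set.abs_sub_left_of_mem_uIcc hx
    have hx' : |x| ≤ |a| + |b| := by linarith [abs_sub_abs_le_abs_sub x a]
    exact (hle x).trans (by gcongr)
  simpa using (convex_uIcc a (a + b)).norm_image_sub_le_of_norm_hasDerivWithin_le
    (fun x _ => (hasDerivAt_primitive hg x).hasDerivWithinAt) hbound
    Set.left_mem_uIcc Set.right_mem_uIcc

theorem exists_primitive_le (hs0 : 0 < s) (hN : 2 * s < N) (hg : Continuous g) (hg1 : CondG1 g)
    (hg2 : CondG2 N s g) : ∃ C, ∀ t, primitive g t ≤ C * (t ^ 2 + |t| ^ critExp N s) := by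
  have hp := critExp_gt_two hs0 hN
  obtain ⟨D, hD0, hD⟩ := exists_abs_le_of_condG2 hg hg2
  obtain ⟨δ, hδ, hsq⟩ := exists_mul_le_sq_of_condG1 hg1
  refine ⟨1 / 2 + D / δ + D, fun t => ?_⟩
  have hpow : 0 ≤ |t| ^ critExp N s := by positivity
  have hDδ : 0 ≤ D / δ := by positivity
  rcases lt_or_ge |t| δ with ht | ht
  · calc primitive g t ≤ 1 / 2 * t ^ 2 := by linarith [primitive_le_of_mul_le_sq hg hsq ht]
      _ ≤ (1 / 2 + D / δ + D) * (t ^ 2 + |t| ^ critExp N s) := by gcongr <;> linarith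
  · have ht0 : 0 < |t| := hδ.trans_le ht
    have hlin : |t| ≤ t ^ 2 / δ := by
      rw [le_div_iff₀ hδ, ← sq_abs, sq]
      gcongr
    calc primitive g t ≤ D * (1 + |t| ^ (critExp N s - 1)) * |t| := by
          simpa [primitive_zero] using
            (le_abs_self _).trans (abs_primitive_sub_le hg hD0 (by linarith) hD 0 t)
      _ = D * (|t| + |t| ^ critExp N s) := by
          rw [Real.rpow_sub_one ht0.ne']
          field_simp
      _ ≤ D * (t ^ 2 / δ + |t| ^ critExp N s) := by gcongr
      _ = D / δ * t ^ 2 + D * |t| ^ critExp N s := by ring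
      _ ≤ (1 / 2 + D / δ + D) * (t ^ 2 + |t| ^ critExp N s) := by
          rw [mul_add]
          gcongr <;> linarith

theorem extIntegral_of_integrable {f : RN N → ℝ} (hf : Integrable f) :
    extIntegral f = ((∫ x, f x : ℝ) : EReal) := by
  rw [extIntegral, integral_eq_lintegral_pos_part_sub_lintegral_neg_part hf, EReal.coe_sub,
    EReal.coe_ennreal_toReal hf.lintegral_lt_top.ne,
    EReal.coe_ennreal_toReal hf.fun_neg.lintegral_lt_top.ne]

theorem extIntegral_of_not_integrable {f : RN N → ℝ} (hfm : AEStronglyMeasurable f)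
    (hf : ¬Integrable f) (hpos : ∫⁻ x, ENNReal.ofReal (f x) < ⊤) : extIntegral f = ⊥ := by
  have hneg : ∫⁻ x, ENNReal.ofReal (-f x) = ⊤ := by
    by_contra hne
    have hsplit : ∀ x, ‖f x‖ₑ = ENNReal.ofReal (f x) + ENNReal.ofReal (-f x) := fun x => by
      rw [← ofReal_norm, Real.norm_eq_abs]
      rcases le_total 0 (f x) with h | h
      · rw [abs_of_nonneg h, ENNReal.ofReal_of_nonpos (neg_nonpos.2 h), add_zero]
      · rw [abs_of_nonpos h, ENNReal.ofReal_of_nonpos h, zero_add]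
    refine hf ⟨hfm, ?_⟩
    rw [HasFiniteIntegral, lintegral_congr hsplit,
      lintegral_add_left' hfm.aemeasurable.ennreal_ofReal]
    exact ENNReal.add_lt_top.2 ⟨hpos, lt_top_iff_ne_top.2 hne⟩
  rw [extIntegral, hneg, EReal.coe_ennreal_top]
  exact EReal.sub_top _

end Nonlinearity

section PerturbedPrimitive

variable {α : Type*} [MeasurableSpace α] {ν : Measure α} {f h : α → ℝ}

theorem integrable_one_add_rpow_mul_abs {p : ℝ} (hp : 1 < p) (hf : MemLp f (ENNReal.ofReal p) ν)
    (hh : MemLp h (ENNReal.ofReal p) ν) (hh1 : Integrable h ν) :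
    Integrable (fun x => (1 + (|f x| + |h x|) ^ (p - 1)) * |h x|) ν := by
  have hsum : Integrable (fun x => (|f x| + |h x|) ^ p) ν := by
    have hnorm := (hf.norm.add hh.norm).integrable_norm_rpow (by simpa using by linarith)
      ENNReal.ofReal_ne_top
    rw [ENNReal.toReal_ofReal (by linarith)] at hnorm
    refine hnorm.congr (.of_forall fun x => ?_)
    simp only [Pi.add_apply, Real.norm_eq_abs]
    rw [abs_of_nonneg (by positivity)]
  have hmeas : AEStronglyMeasurable (fun x => (1 + (|f x| + |h x|) ^ (p - 1)) * |h x|) ν := by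
    have hfm := hf.aestronglyMeasurable.aemeasurable
    have hhm := hh.aestronglyMeasurable.aemeasurable
    exact AEMeasurable.aestronglyMeasurable (by fun_prop)
  refine (hh1.abs.add hsum).mono' hmeas (.of_forall fun x => ?_)
  calc ‖(1 + (|f x| + |h x|) ^ (p - 1)) * |h x|‖
      = |h x| + (|f x| + |h x|) ^ (p - 1) * |h x| := by
        rw [Real.norm_of_nonneg (by positivity), add_mul, one_mul]
    _ ≤ |h x| + (|f x| + |h x|) ^ (p - 1) * (|f x| + |h x|) ^ (1 : ℝ) := by
        rw [Real.rpow_one]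
        gcongr
        exact le_add_of_nonneg_left (abs_nonneg _)
    _ = |h x| + (|f x| + |h x|) ^ p := by
        rw [← Real.rpow_add_of_nonneg (by positivity) (by linarith) zero_le_one, sub_add_cancel]

variable {g : ℝ → ℝ} {C q : ℝ}

theorem integrable_primitive_add (hg : Continuous g) (hC : 0 ≤ C) (hq : 0 ≤ q)
    (hle : ∀ t, |g t| ≤ C * (1 + |t| ^ q)) (hf : AEStronglyMeasurable f ν)
    (hh : AEStronglyMeasurable h ν) (hint : Integrable (fun x => primitive g (f x)) ν)
    (hdom : Integrable (fun x => (1 + (|f x| + |h x|) ^ q) * |h x|) ν) :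
    Integrable (fun x => primitive g (f x + h x)) ν := by
  have hcont := continuous_primitive hg
  have hdiff : Integrable (fun x => primitive g (f x + h x) - primitive g (f x)) ν :=
    (hdom.const_mul C).mono' ((hcont.comp_aestronglyMeasurable (hf.add hh)).sub
      (hcont.comp_aestronglyMeasurable hf)) (.of_forall fun x => by
        rw [Real.norm_eq_abs, ← mul_assoc]
        exact abs_primitive_sub_le hg hC hq hle _ _)
  exact (hdiff.add hint).congr (.of_forall fun x => sub_add_cancel _ _)

theorem hasDerivAt_integral_primitive_add_mul (hg : Continuous g) (hC : 0 ≤ C) (hq : 0 ≤ q)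
    (hle : ∀ t, |g t| ≤ C * (1 + |t| ^ q)) (hf : AEStronglyMeasurable f ν)
    (hh : AEStronglyMeasurable h ν) (hint : Integrable (fun x => primitive g (f x)) ν)
    (hdom : Integrable (fun x => (1 + (|f x| + |h x|) ^ q) * |h x|) ν) :
    HasDerivAt (fun t : ℝ => ∫ x, primitive g (f x + t * h x) ∂ν) (∫ x, g (f x) * h x ∂ν) 0 := by
  have hderiv : ∀ x, ∀ t ∈ Metric.ball (0 : ℝ) 1,
      HasDerivAt (fun t => primitive g (f x + t * h x)) (g (f x + t * h x) * h x) t :=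
    fun x t _ => HasDerivAt.comp (h₂ := primitive g) t (hasDerivAt_primitive hg _)
      ((hasDerivAt_mul_const (h x)).const_add (f x))
  have hbound : ∀ x, ∀ t ∈ Metric.ball (0 : ℝ) 1,
      ‖g (f x + t * h x) * h x‖ ≤ C * ((1 + (|f x| + |h x|) ^ q) * |h x|) := fun x t ht => by
    have hshift : |f x + t * h x| ≤ |f x| + |h x| := by
      refine (abs_add_le _ _).trans ?_
      rw [abs_mul]
      gcongr
      exact mul_le_of_le_one_left (abs_nonneg _) (by simpa using (mem_ball_zero_iff.1 ht).le)
    rw [norm_mul, ← mul_assoc]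
    exact mul_le_mul_of_nonneg_right ((hle _).trans (by gcongr)) (norm_nonneg _)
  simpa using (hasDerivAt_integral_of_dominated_loc_of_deriv_le (x₀ := (0 : ℝ))
    (F' := fun t x => g (f x + t * h x) * h x) (Metric.ball_mem_nhds 0 one_pos)
    (.of_forall fun t =>
      (continuous_primitive hg).comp_aestronglyMeasurable (hf.add (hh.const_mul t)))
    (by simpa using hint) ((hg.comp_aestronglyMeasurable (hf.add (hh.const_mul 0))).mul hh)
    (.of_forall hbound) (hdom.const_mul C) (.of_forall hderiv)).2

end PerturbedPrimitive

section Potential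

variable {N : ℕ} {s : ℝ} {g : ℝ → ℝ} {u φ : Hs N s}

/-- The potential energy density `G(u)` is integrable, which under (g0)-(g2) means that `∫ G(u)`
is not `-∞`. -/
def FinitePotential (g : ℝ → ℝ) (u : Hs N s) : Prop :=
  Integrable fun x => primitive g (u x)

/-- The real number `∫ G(u)`; this is the potential when `FinitePotential g u` holds, and the junk
value `0` of the Bochner integral otherwise. -/
def potentialReal (g : ℝ → ℝ) (u : Hs N s) : ℝ :=
  ∫ x, primitive g (u x)

theorem FinitePotential.potential_eq (h : FinitePotential g u) :
    potential g u = (potentialReal g u : EReal) :=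
  extIntegral_of_integrable h

theorem potential_eq_bot (hs0 : 0 < s) (hN : 2 * s < N) (hg : Continuous g) (hg1 : CondG1 g)
    (hg2 : CondG2 N s g) (h : ¬FinitePotential g u) : potential g u = ⊥ := by
  obtain ⟨C, hle⟩ := exists_primitive_le hs0 hN hg hg1 hg2
  have hint : Integrable fun x => C * (u x ^ 2 + |u x| ^ critExp N s) :=
    ((Lp.memLp u.1).integrable_sq.add (integrable_abs_rpow_critExp hs0 hN u)).const_mul C
  exact extIntegral_of_not_integrable
    ((continuous_primitive hg).comp_aestronglyMeasurable (Lp.aestronglyMeasurable _)) h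
    ((lintegral_mono fun x => ENNReal.ofReal_le_ofReal (hle _)).trans_lt hint.lintegral_lt_top)

theorem FinitePotential.energy_eq (h : FinitePotential g u) :
    energy g u = (kinetic u / 2 - potentialReal g u : ℝ) := by
  rw [energy, h.potential_eq, EReal.coe_sub]

theorem energy_eq_top (hs0 : 0 < s) (hN : 2 * s < N) (hg : Continuous g) (hg1 : CondG1 g)
    (hg2 : CondG2 N s g) (h : ¬FinitePotential g u) : energy g u = ⊤ := by
  rw [energy, potential_eq_bot hs0 hN hg hg1 hg2 h]
  exact EReal.coe_sub_bot _

theorem FinitePotential.lagrangian_eq (h : FinitePotential g u) (m μ : ℝ) :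
    lagrangian g m (μ, u) = (kinetic u / 2 + μ / 2 * (mass u - m) - potentialReal g u : ℝ) := by
  rw [lagrangian, h.potential_eq, EReal.coe_sub]

theorem FinitePotential.pohozaev_eq (h : FinitePotential g u) (μ : ℝ) : pohozaev g (μ, u)
    = (kinetic u + critExp N s * (μ / 2 * mass u - potentialReal g u) : ℝ) := by
  rw [pohozaev, h.potential_eq, ← EReal.coe_sub, ← EReal.coe_mul, ← EReal.coe_add]

theorem finitePotential_zero (g : ℝ → ℝ) : FinitePotential g (0 : Hs N s) := by
  refine (integrable_zero (RN N) ℝ volume).congr ?_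
  filter_upwards [Lp.coeFn_zero ℝ 2 (volume : Measure (RN N))] with x hx
  rw [Submodule.coe_zero, hx, Pi.zero_apply, primitive_zero]

theorem integrable_one_add_rpow_critExp_mul_abs (hs0 : 0 < s) (hN : 2 * s < N) (u : Hs N s)
    (hφ : Integrable φ) :
    Integrable fun x => (1 + (|u x| + |φ x|) ^ (critExp N s - 1)) * |φ x| :=
  integrable_one_add_rpow_mul_abs (one_lt_two.trans (critExp_gt_two hs0 hN))
    (memLp_critExp hs0 hN u) (memLp_critExp hs0 hN φ) hφ

theorem FinitePotential.add (hs0 : 0 < s) (hN : 2 * s < N) (hg : Continuous g)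
    (hg2 : CondG2 N s g) (hu : FinitePotential g u) (hφ : Integrable φ) :
    FinitePotential g (u + φ) := by
  obtain ⟨C, hC, hle⟩ := exists_abs_le_of_condG2 hg hg2
  refine (integrable_primitive_add hg hC (by linarith [critExp_gt_two hs0 hN]) hle
    (Lp.aestronglyMeasurable _) (Lp.aestronglyMeasurable _) hu
    (integrable_one_add_rpow_critExp_mul_abs hs0 hN u hφ)).congr ?_
  filter_upwards [Lp.coeFn_add u.1 φ.1] with x hx
  rw [Submodule.coe_add, hx, Pi.add_apply]

theorem finitePotential_of_integrable (hs0 : 0 < s) (hN : 2 * s < N) (hg : Continuous g)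
    (hg2 : CondG2 N s g) (hφ : Integrable φ) : FinitePotential g φ := by
  simpa using (finitePotential_zero g).add hs0 hN hg hg2 hφ

theorem hasDerivAt_potentialReal (hs0 : 0 < s) (hN : 2 * s < N) (hg : Continuous g)
    (hg2 : CondG2 N s g) (hu : FinitePotential g u) (hφ : Integrable φ) :
    HasDerivAt (fun t : ℝ => potentialReal g (u + t • φ)) (∫ x, g (u x) * φ x) 0 := by
  obtain ⟨C, hC, hle⟩ := exists_abs_le_of_condG2 hg hg2
  refine (hasDerivAt_integral_primitive_add_mul hg hC (by linarith [critExp_gt_two hs0 hN]) hle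
    (Lp.aestronglyMeasurable _) (Lp.aestronglyMeasurable _) hu
    (integrable_one_add_rpow_critExp_mul_abs hs0 hN u hφ)).congr_of_eventuallyEq
    (.of_forall fun t => integral_congr_ae ?_)
  filter_upwards [Lp.coeFn_add u.1 (t • φ.1), Lp.coeFn_smul t φ.1] with x hadd hsmul
  rw [Submodule.coe_add, Submodule.coe_smul, hadd, Pi.add_apply, hsmul, Pi.smul_apply, smul_eq_mul]

end Potential

section Reduction

variable {N : ℕ} {s m μ : ℝ} {g : ℝ → ℝ} {u : Hs N s}

/-- The nonzero functions whose potential is finite. These are the functions which occur in the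
Pohozaev set, each of them with exactly one multiplier. -/
def admissible (N : ℕ) (s : ℝ) (g : ℝ → ℝ) : Set (Hs N s) :=
  {v | v ≠ 0 ∧ FinitePotential g v}

/-- The multiplier `μ` determined by `P(μ,u) = 0`. -/
def pohozaevMultiplier (g : ℝ → ℝ) (u : Hs N s) : ℝ :=
  2 / mass u * (potentialReal g u - kinetic u / critExp N s)

/-- The value `I^m(μ,u)` at the multiplier `μ` determined by `P(μ,u) = 0`. -/
def reducedLagrangian (g : ℝ → ℝ) (m : ℝ) (u : Hs N s) : ℝ :=
  s / N * kinetic u - m / mass u * (potentialReal g u - kinetic u / critExp N s)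

theorem mem_admissible_of_mass_eq (hm : m ≠ 0) (hmass : mass u = m) (h : FinitePotential g u) :
    u ∈ admissible N s g := by
  refine ⟨?_, h⟩
  rintro rfl
  exact hm (hmass.symm.trans mass_zero)

theorem mem_pohozaevSet_iff (hs0 : 0 < s) (hN : 2 * s < N) (hg : Continuous g) (hg1 : CondG1 g)
    (hg2 : CondG2 N s g) :
    (μ, u) ∈ pohozaevSet N s g ↔ u ∈ admissible N s g ∧ μ = pohozaevMultiplier g u := by
  have hp : 0 < critExp N s := by linarith [critExp_gt_two hs0 hN]
  rw [pohozaevSet, Set.mem_ofPred_eq, admissible, Set.mem_ofPred_eq, and_assoc]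
  refine and_congr_right fun hu => ?_
  by_cases h : FinitePotential g u
  · have hmass := (mass_pos hu).ne'
    rw [h.pohozaev_eq, EReal.coe_eq_zero, pohozaevMultiplier, and_iff_right h]
    field_simp
    constructor <;> intro heq <;> linarith
  · refine iff_of_false ?_ fun hfin => h hfin.1
    rw [pohozaev, potential_eq_bot hs0 hN hg hg1 hg2 h, EReal.coe_sub_bot,
      EReal.coe_mul_top_of_pos hp, EReal.coe_add_top]
    exact EReal.top_ne_zero

theorem half_eq_div_add_inv_critExp (hN : N ≠ 0) (s : ℝ) :
    (2 : ℝ)⁻¹ = s / N + (critExp N s)⁻¹ := by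
  rw [critExp]
  field_simp
  ring

theorem lagrangian_pohozaevMultiplier (hN : N ≠ 0) (m : ℝ)
    (hu : u ∈ admissible N s g) :
    lagrangian g m (pohozaevMultiplier g u, u) = reducedLagrangian g m u := by
  have hmass := (mass_pos hu.1).ne'
  rw [hu.2.lagrangian_eq, EReal.coe_eq_coe_iff, pohozaevMultiplier, reducedLagrangian,
    div_eq_mul_inv (kinetic u) 2, half_eq_div_add_inv_critExp hN s]
  field_simp
  ring

theorem reducedLagrangian_of_mass_eq (hN : N ≠ 0) (hm : m ≠ 0)
    (hmass : mass u = m) : reducedLagrangian g m u = kinetic u / 2 - potentialReal g u := by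
  rw [reducedLagrangian, hmass, div_self hm, div_eq_mul_inv (kinetic u) 2,
    half_eq_div_add_inv_critExp hN s]
  ring

theorem FinitePotential.energy_eq_reducedLagrangian (hN : N ≠ 0) (hm : m ≠ 0)
    (hmass : mass u = m) (h : FinitePotential g u) : energy g u = reducedLagrangian g m u := by
  rw [h.energy_eq, reducedLagrangian_of_mass_eq hN hm hmass]

theorem isPohozaevMinimum_iff (hs0 : 0 < s) (hN : 2 * s < N) (hg : Continuous g)
    (hg1 : CondG1 g) (hg2 : CondG2 N s g) :
    IsPohozaevMinimum g m μ u ↔ u ∈ admissible N s g ∧ μ = pohozaevMultiplier g u ∧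
      IsMinOn (reducedLagrangian g m) (admissible N s g) u := by
  have hN0 := ne_zero_of_two_mul_lt hs0 hN
  rw [IsPohozaevMinimum, mem_pohozaevSet_iff hs0 hN hg hg1 hg2, and_assoc]
  refine and_congr_right fun hu => and_congr_right fun hμ => ?_
  rw [isMinOn_iff, isMinOn_iff, hμ, lagrangian_pohozaevMultiplier hN0 m hu]
  constructor
  · intro hmin v hv
    have hle := hmin _ ((mem_pohozaevSet_iff hs0 hN hg hg1 hg2).2 ⟨hv, rfl⟩)
    rwa [lagrangian_pohozaevMultiplier hN0 m hv, EReal.coe_le_coe_iff] at hle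
  · rintro hmin ⟨ν, v⟩ hv
    obtain ⟨hv', rfl⟩ := (mem_pohozaevSet_iff hs0 hN hg hg1 hg2).1 hv
    rw [lagrangian_pohozaevMultiplier hN0 m hv', EReal.coe_le_coe_iff]
    exact hmin v hv'

end Reduction

section Normalization

variable {N : ℕ} {s m : ℝ} {g : ℝ → ℝ} {u v : Hs N s}

/-- The spatial rescaling of `v ≠ 0` which has mass `m`. -/
def normalize (hm : 0 < m) (hv : v ≠ 0) : Hs N s :=
  rescale (Real.rpow_pos_of_pos (div_pos hm (mass_pos hv)) (N : ℝ)⁻¹) v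

theorem mass_normalize (hN : N ≠ 0) (hm : 0 < m) (hv : v ≠ 0) : mass (normalize hm hv) = m := by
  have hM := mass_pos hv
  rw [normalize, mass_rescale, Real.rpow_inv_natCast_pow (by positivity) hN,
    div_mul_cancel₀ _ hM.ne']

theorem potentialReal_normalize (hN : N ≠ 0) (g : ℝ → ℝ) (hm : 0 < m) (hv : v ≠ 0) :
    potentialReal g (normalize hm hv) = m / mass v * potentialReal g v := by
  have hM := mass_pos hv
  rw [normalize, potentialReal, integral_comp_rescale,
    Real.rpow_inv_natCast_pow (by positivity) hN, potentialReal]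

theorem kinetic_normalize (hm : 0 < m) (hv : v ≠ 0) :
    kinetic (normalize hm hv) = (m / mass v) ^ ((N - 2 * s) / N) * kinetic v := by
  have hM := mass_pos hv
  rw [normalize, kinetic_rescale, ← Real.rpow_mul (by positivity), inv_mul_eq_div]

theorem normalize_mem_admissible (hN : N ≠ 0) (hm : 0 < m) (hv : v ∈ admissible N s g) :
    normalize hm hv.1 ∈ admissible N s g :=
  mem_admissible_of_mass_eq hm.ne' (mass_normalize hN hm hv.1) (integrable_comp_rescale _ v hv.2)

theorem reducedLagrangian_sub_normalize (hN : N ≠ 0) (g : ℝ → ℝ) (hm : 0 < m) (hv : v ≠ 0) :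
    reducedLagrangian g m v - reducedLagrangian g m (normalize hm hv)
      = kinetic v / 2 * (1 + (N - 2 * s) / N * (m / mass v - 1)
          - (1 + (m / mass v - 1)) ^ ((N - 2 * s) / N)) := by
  have hsN : s / N = (1 - (N - 2 * s) / N) / 2 := by field_simp; ring
  have hcrit : kinetic v / critExp N s = (N - 2 * s) / N * (kinetic v / 2) := by
    rw [critExp]
    field_simp
  rw [reducedLagrangian_of_mass_eq hN hm.ne' (mass_normalize hN hm hv), kinetic_normalize,
    potentialReal_normalize hN, reducedLagrangian, hcrit, hsN, add_sub_cancel]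
  ring

theorem reducedLagrangian_normalize_le (hs0 : 0 < s) (hN : 2 * s < N) (g : ℝ → ℝ) (hm : 0 < m)
    (hv : v ≠ 0) : reducedLagrangian g m (normalize hm hv) ≤ reducedLagrangian g m v := by
  have hN0 := ne_zero_of_two_mul_lt hs0 hN
  have hNr : (0 : ℝ) < N := by linarith
  have hquot : 0 < m / mass v := div_pos hm (mass_pos hv)
  rw [← sub_nonneg, reducedLagrangian_sub_normalize hN0]
  refine mul_nonneg (half_pos (kinetic_pos hN0 hv)).le (sub_nonneg.2 ?_)
  exact rpow_one_add_le_one_add_mul_self (by linarith) (div_nonneg (by linarith) hNr.le)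
    ((div_le_one hNr).2 (by linarith))

theorem reducedLagrangian_normalize_lt (hs0 : 0 < s) (hN : 2 * s < N) (g : ℝ → ℝ) (hm : 0 < m)
    (hv : v ≠ 0) (hne : mass v ≠ m) :
    reducedLagrangian g m (normalize hm hv) < reducedLagrangian g m v := by
  have hN0 := ne_zero_of_two_mul_lt hs0 hN
  have hNr : (0 : ℝ) < N := by linarith
  have hquot : 0 < m / mass v := div_pos hm (mass_pos hv)
  have hquot1 : m / mass v - 1 ≠ 0 := fun h =>
    hne ((div_eq_one_iff_eq (mass_pos hv).ne').1 (sub_eq_zero.1 h)).symm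
  rw [← sub_pos, reducedLagrangian_sub_normalize hN0]
  refine mul_pos (half_pos (kinetic_pos hN0 hv)) (sub_pos.2 ?_)
  exact rpow_one_add_lt_one_add_mul_self (by linarith) hquot1 (div_pos (by linarith) hNr)
    ((div_lt_one hNr).2 (by linarith))

theorem mass_eq_of_isMinOn (hs0 : 0 < s) (hN : 2 * s < N) (hm : 0 < m)
    (hu : u ∈ admissible N s g) (hmin : IsMinOn (reducedLagrangian g m) (admissible N s g) u) :
    mass u = m := by
  have hN0 := ne_zero_of_two_mul_lt hs0 hN
  by_contra hne
  exact (reducedLagrangian_normalize_lt hs0 hN g hm hu.1 hne).not_ge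
    (isMinOn_iff.1 hmin _ (normalize_mem_admissible hN0 hm hu))

theorem admissible_nonempty (hs0 : 0 < s) (hN : 2 * s < N) (hg : Continuous g)
    (hg2 : CondG2 N s g) (hu : u ≠ 0) : (admissible N s g).Nonempty := by
  obtain ⟨φ, hφ, hne⟩ := exists_integrable_integral_mul_ne_zero hs0.le
    (w := u.1) fun h => hu (Subtype.ext h)
  refine ⟨φ, ?_, finitePotential_of_integrable hs0 hN hg hg2 hφ⟩
  rintro rfl
  rw [integral_mul_eq_inner, Submodule.coe_zero, inner_zero_right] at hne
  exact hne rfl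

theorem isMinOn_energy_sphere_iff (hs0 : 0 < s) (hN : 2 * s < N) (hm : 0 < m)
    (hg : Continuous g) (hg1 : CondG1 g) (hg2 : CondG2 N s g) (hmass : mass u = m) :
    IsMinOn (energy g) (sphere N s m) u ↔
      u ∈ admissible N s g ∧ IsMinOn (reducedLagrangian g m) (admissible N s g) u := by
  have hN0 := ne_zero_of_two_mul_lt hs0 hN
  have energy_eq {w : Hs N s} (hw : mass w = m) (hfin : FinitePotential g w) :=
    hfin.energy_eq_reducedLagrangian hN0 hm.ne' hw
  rw [isMinOn_iff, isMinOn_iff]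
  constructor
  · intro hmin
    have hle {v : Hs N s} (hv : v ∈ admissible N s g) :
        energy g u ≤ (reducedLagrangian g m v : EReal) := by
      have hw := mass_normalize hN0 hm hv.1
      refine (hmin _ hw).trans ?_
      rw [energy_eq hw (normalize_mem_admissible hN0 hm hv).2, EReal.coe_le_coe_iff]
      exact reducedLagrangian_normalize_le hs0 hN g hm hv.1
    have hu : u ∈ admissible N s g := by
      have hu0 : u ≠ 0 := by rintro rfl; exact hm.ne (mass_zero.symm.trans hmass)
      obtain ⟨v, hv⟩ := admissible_nonempty hs0 hN hg hg2 hu0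
      refine ⟨hu0, by_contra fun hfin => ?_⟩
      exact ((hle hv).trans_lt (EReal.coe_lt_top _)).ne (energy_eq_top hs0 hN hg hg1 hg2 hfin)
    exact ⟨hu, fun v hv => EReal.coe_le_coe_iff.1 (energy_eq hmass hu.2 ▸ hle hv)⟩
  · rintro ⟨hu, hmin⟩ v hv
    by_cases hfin : FinitePotential g v
    · rw [energy_eq hmass hu.2, energy_eq hv hfin, EReal.coe_le_coe_iff]
      exact hmin v (mem_admissible_of_mass_eq hm.ne' hv hfin)
    · rw [energy_eq_top hs0 hN hg hg1 hg2 hfin]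
      exact le_top

end Normalization

section EulerLagrange

variable {N : ℕ} {s m μ ν : ℝ} {g : ℝ → ℝ} {u φ : Hs N s}

theorem hasDerivAt_reducedLagrangian (hs0 : 0 < s) (hN : 2 * s < N) (hm : m ≠ 0)
    (hg : Continuous g) (hg2 : CondG2 N s g) (hmass : mass u = m) (hu : FinitePotential g u)
    (hφ : Integrable φ) :
    HasDerivAt (fun t : ℝ => reducedLagrangian g m (u + t • φ))
      (kineticForm u φ + pohozaevMultiplier g u * (∫ x, u x * φ x) - ∫ x, g (u x) * φ x) 0 := by
  have hT := hasDerivAt_kinetic u φ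
  have hV := hasDerivAt_potentialReal hs0 hN hg hg2 hu hφ
  have hM0 : mass (u + (0 : ℝ) • φ) ≠ 0 := by rwa [zero_smul, add_zero, hmass]
  refine ((hT.const_mul (s / N)).sub (((hasDerivAt_const (0 : ℝ) m).fun_div
    (hasDerivAt_mass u φ) hM0).fun_mul (hV.sub (hT.div_const (critExp N s))))).congr_deriv ?_
  have hsN : s / N = 2⁻¹ - (critExp N s)⁻¹ := by
    linarith [half_eq_div_add_inv_critExp (ne_zero_of_two_mul_lt hs0 hN) s]
  simp only [zero_smul, add_zero, Pi.sub_apply, hmass, pohozaevMultiplier, hsN]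
  field_simp
  ring

theorem eventually_add_smul_mem_admissible (hs0 : 0 < s) (hN : 2 * s < N) (hg : Continuous g)
    (hg2 : CondG2 N s g) (hu : u ∈ admissible N s g) (hφ : Integrable φ) :
    ∀ᶠ t : ℝ in 𝓝 0, u + t • φ ∈ admissible N s g := by
  have hpos : ∀ᶠ t : ℝ in 𝓝 0, 0 < mass (u + t • φ) :=
    (hasDerivAt_mass u φ).continuousAt.eventually_const_lt (by simpa using mass_pos hu.1)
  filter_upwards [hpos] with t ht
  have htφ : Integrable (t • φ : Hs N s) :=
    (hφ.const_mul t).congr (Lp.coeFn_smul t φ.1).symm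
  exact mem_admissible_of_mass_eq ht.ne' rfl (hu.2.add hs0 hN hg hg2 htφ)

theorem isWeakSolution_of_isMinOn (hs0 : 0 < s) (hN : 2 * s < N) (hm : m ≠ 0)
    (hg : Continuous g) (hg2 : CondG2 N s g) (hmass : mass u = m) (hu : u ∈ admissible N s g)
    (hmin : IsMinOn (reducedLagrangian g m) (admissible N s g) u) :
    IsWeakSolution g (pohozaevMultiplier g u) u := by
  intro φ hφ
  have hlocal : IsLocalMin (fun t : ℝ => reducedLagrangian g m (u + t • φ)) 0 := by
    filter_upwards [eventually_add_smul_mem_admissible hs0 hN hg hg2 hu hφ] with t ht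
    simpa using isMinOn_iff.1 hmin _ ht
  exact sub_eq_zero.1 (hlocal.hasDerivAt_eq_zero
    (hasDerivAt_reducedLagrangian hs0 hN hm hg hg2 hmass hu.2 hφ))

theorem IsWeakSolution.multiplier_unique (hs : 0 ≤ s) (hu : u ≠ 0) (hμ : IsWeakSolution g μ u)
    (hν : IsWeakSolution g ν u) : μ = ν := by
  obtain ⟨φ, hφ, hne⟩ := exists_integrable_integral_mul_ne_zero hs
    (w := u.1) fun h => hu (Subtype.ext h)
  exact mul_right_cancel₀ hne (by linarith [hμ φ hφ, hν φ hφ])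

end EulerLagrange

end FracNLS

end

open FracNLS in
theorem corollary1p8_general (N : ℕ) (s m : ℝ) (hs0 : 0 < s) (hN : 2 * s < N) (hm : 0 < m)
    (g : ℝ → ℝ) (hg : Continuous g) (hg1 : CondG1 g) (hg2 : CondG2 N s g) (μ : ℝ) (u : Hs N s) :
    IsL2Minimum g m μ u ↔ IsPohozaevMinimum g m μ u := by
  have solves (hmass : mass u = m) (hu : u ∈ admissible N s g) :=
    isWeakSolution_of_isMinOn hs0 hN hm.ne' hg hg2 hmass hu
  rw [isPohozaevMinimum_iff hs0 hN hg hg1 hg2]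
  constructor
  · rintro ⟨hmass, hmin, hweak⟩
    obtain ⟨hu, hred⟩ := (isMinOn_energy_sphere_iff hs0 hN hm hg hg1 hg2 hmass).1 hmin
    exact ⟨hu, hweak.multiplier_unique hs0.le hu.1 (solves hmass hu hred), hred⟩
  · rintro ⟨hu, rfl, hred⟩
    have hmass := mass_eq_of_isMinOn hs0 hN hm hu hred
    exact ⟨hmass, (isMinOn_energy_sphere_iff hs0 hN hm hg hg1 hg2 hmass).2 ⟨hu, hred⟩,
      solves hmass hu hred⟩

theorem corollary1p8 (N : ℕ) (s m : ℝ) (hs0 : 0 < s) (hs1 : s < 1) (hN : 2 * s < N) (hm : 0 < m)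
    (g : ℝ → ℝ) (hg0 : FracNLS.CondG0 g) (hg1 : FracNLS.CondG1 g) (hg2 : FracNLS.CondG2 N s g)
    (μ : ℝ) (u : FracNLS.Hs N s) :
    FracNLS.IsL2Minimum g m μ u ↔ FracNLS.IsPohozaevMinimum g m μ u :=
  corollary1p8_general N s m hs0 hN hm g hg0.1 hg1 hg2 μ u
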